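/- Let $T>0$, $x_0\in(0,1)$, $\mathcal O_T=[0,T]\times[0,1]$, and let $C(\mathcal O_T)$ be the space of real continuous functions on $\mathcal O_T$ with the supremum norm. Let $b,\sigma:\mathbb R\to\mathbb R$ satisfy $|b(x)-b(z)|+|\sigma(x)-\sigma(z)|\le L|x-z|$ for all $x,z\in\mathbb R$ and some $L>0$, let $u_0\in C^2([0,1])$ with $u_0(0)=u_0(1)=0$, and let $v_0\in C^1([0,1])$. Put $\varphi_j(x)=\sqrt2\sin(j\pi x)$ and, with the series understood as the limit of its partial sums, $$G_t(x,z)=\sum_{j=1}^\infty\frac{\sin(j\pi t)}{j\pi}\varphi_j(x)\varphi_j(z).$$ For $n\in\mathbb N^+$ put $\kappa_n(z)=\lfloor nz\rfloor/n$, $c^n_j=\sin^2(\tfrac{j\pi}{2n})/(\tfrac{j\pi}{2n})^2$, let $\varphi_{j,n}$ be the piecewise linear interpolation of $\varphi_j$ with nodes $0,\frac1n,\dots,1$, and put $$G^n_t(x,z)=\sum_{j=1}^{n-1}\frac{\sin(j\pi t\sqrt{c^n_j})}{j\pi\sqrt{c^n_j}}\varphi_{j,n}(x)\varphi_j(\kappa_n(z)).$$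 For $h\in L^2(\mathcal O_T)$ let $\Upsilon(h)\in C(\mathcal O_T)$ be the solution $f$ of $$f(t,x)=\int_0^1G_t(x,z)v_0(z)\,dz+\frac{\partial}{\partial t}\int_0^1G_t(x,z)u_0(z)\,dz+\int_0^t\!\!\int_0^1G_{t-s}(x,z)\bigl[b(f(s,z))+\sigma(f(s,z))h(s,z)\bigr]dz\,ds,$$ and let $\Upsilon^n(h)\in C(\mathcal O_T)$ be the solution $f$ of $$f(t,x)=\int_0^1G^n_t(x,z)v_0(\kappa_n(z))\,dz+\int_0^1\frac{\partial}{\partial t}G^n_t(x,z)u_0(\kappa_n(z))\,dz+\int_0^t\!\!\int_0^1G^n_{t-s}(x,z)\bigl[b(f(s,\kappa_n(z)))+\sigma(f(s,\kappa_n(z)))h(s,z)\bigr]dz\,ds,$$ both for all $(t,x)\in\mathcal O_T$. For $y\in\mathbb R$ and $f\in C(\mathcal O_T)$ let $$J_y(f)=\begin{cases}\inf\{\tfrac12\|h\|_{L^2(\mathcal O_T)}^2:\ h\in L^2(\mathcal O_T),\ \Upsilon(h)=f\}&\text{if } f(T,x_0)=y \text{ and } f\in\operatorname{Im}\Upsilon,\\+\infty&\text{otherwise,}\end{cases}$$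 and let $J^n_y$ be defined in the same way with $\Upsilon^n$ in place of $\Upsilon$. A sequence of functionals $F_n:X\to[-\infty,+\infty]$ on a metric space $X$ $\Gamma$-converges to $F$ if $\liminf_nF_n(x_n)\ge F(x)$ whenever $x_n\to x$, and every $x\in X$ admits a sequence $x_n\to x$ with $\limsup_nF_n(x_n)\le F(x)$. **Theorem 3.1.** Assume $\sigma(x)\ne0$ for all $x\in\mathbb R$, and fix $y\in\mathbb R$. For every $h\in L^2(\mathcal O_T)$ and $n\in\mathbb N^+$ the two equations above have exactly one solution in $C(\mathcal O_T)$, so that $\Upsilon$ and $\Upsilon^n$ are well defined. Every subsequence $(J^{n_k}_y)_{k}$ of $(J^n_y)_{n\in\mathbb N^+}$ has a further subsequence $(J^{n_{k_j}}_y)_{j}$ which $\Gamma$-converges to $J_y$ on $C(\mathcal O_T)$. Hence the whole sequence $(J^n_y)_{n\in\mathbb N^+}$ $\Gamma$-converges to $J_y$ on $C(\mathcal O_T)$. -/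

import Mathlib

open MeasureTheory Filter Topology Set

namespace WaveGamma

noncomputable section

/-! ### Gamma-convergence -/

/-- Sequential Gamma-convergence of extended-real functionals on a metric space:
the liminf inequality along every convergent sequence, and a recovery sequence at every point. -/
def GammaConverges {X : Type*} [MetricSpace X] (F : ℕ+ → X → EReal) (F₀ : X → EReal) : Prop :=
  (∀ (x : X) (u : ℕ+ → X), Tendsto u atTop (𝓝 x) →
      F₀ x ≤ liminf (fun n => F n (u n)) atTop) ∧
  (∀ x : X, ∃ u : ℕ+ → X, Tendsto u atTop (𝓝 x) ∧
      limsup (fun n => F n (u n)) atTop ≤ F₀ x)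

/-! ### The space-time domain, continuous functions and square integrable functions on it -/

/-- The rectangle `[0,T] × [0,1]`. -/
def OT (T : ℝ) : Set (ℝ × ℝ) := Icc 0 T ×ˢ Icc 0 1

instance instCompactSpaceOT (T : ℝ) : CompactSpace (OT T) :=
  isCompact_iff_compactSpace.mp (isCompact_Icc.prod isCompact_Icc)

/-- Real square integrable functions on `[0,T] × [0,1]` (Lebesgue measure). -/
abbrev L2OT (T : ℝ) : Type := Lp ℝ 2 ((volume : Measure (ℝ × ℝ)).restrict (OT T))

open Classical in
/-- The value `f (t, x)` of a function on `[0,T] × [0,1]`; the value `0` off the rectangle is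
never used. -/
def ev {T : ℝ} (f : C(OT T, ℝ)) (t x : ℝ) : ℝ :=
  if h : (t, x) ∈ OT T then f ⟨(t, x), h⟩ else 0

/-! ### The Green functions -/

/-- `φ_j(x) = √2 sin(jπx)`. -/
def phi (j : ℕ) (x : ℝ) : ℝ := √2 * Real.sin (j * Real.pi * x)

/-- Green function of the wave operator with Dirichlet boundary conditions,
`G_t(x,y) = ∑_{j ≥ 1} sin(jπt)/(jπ) φ_j(x) φ_j(y)`. The series converges for all `t, x, y`, but
in general only conditionally, so it is the limit of its partial sums (and not a `tsum`). -/
def green (t x y : ℝ) : ℝ :=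
  limUnder atTop (fun N : ℕ => ∑ j ∈ Finset.Icc 1 N,
    Real.sin (j * Real.pi * t) / (j * Real.pi) * phi j x * phi j y)

/-- `κ_n(z) = ⌊zn⌋ / n`. -/
def kappa (n : ℕ) (z : ℝ) : ℝ := (⌊z * n⌋ : ℝ) / n

/-- Linear interpolation `Π_n(w)` of `w` with nodes `0, 1/n, …, 1`. -/
def interp (n : ℕ) (w : ℝ → ℝ) (x : ℝ) : ℝ :=
  w (kappa n x) + (n * x - (⌊n * x⌋ : ℝ)) * (w (kappa n x + 1 / n) - w (kappa n x))

/-- `c_j^n = sin²(jπ/(2n)) / (jπ/(2n))²`. -/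
def cCoef (n j : ℕ) : ℝ :=
  Real.sin (j / (2 * n) * Real.pi) ^ 2 / (j / (2 * n) * Real.pi) ^ 2

/-- Discrete Green function
`G^n_t(x,y) = ∑_{j=1}^{n-1} sin(jπt√c_j^n)/(jπ√c_j^n) Π_n(φ_j)(x) φ_j(κ_n(y))`. -/
def greenD (n : ℕ) (t x y : ℝ) : ℝ :=
  ∑ j ∈ Finset.Ico 1 n,
    Real.sin (j * Real.pi * t * √(cCoef n j)) / (j * Real.pi * √(cCoef n j)) *
      interp n (phi j) x * phi j (kappa n y)

/-! ### The skeleton equations -/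

/-- `f` solves the skeleton equation driven by `h`. The formula for the Green function makes sense
for all real times, so the time derivative at `t = 0` and `t = T` is an ordinary derivative. -/
def IsSkeletonSol {T : ℝ} (b σ u₀ v₀ : ℝ → ℝ) (h : L2OT T) (f : C(OT T, ℝ)) : Prop :=
  ∀ t ∈ Icc (0 : ℝ) T, ∀ x ∈ Icc (0 : ℝ) 1,
    ev f t x =
      (∫ z in (0 : ℝ)..1, green t x z * v₀ z)
      + deriv (fun τ : ℝ => ∫ z in (0 : ℝ)..1, green τ x z * u₀ z) t
      + (∫ s in (0 : ℝ)..t, ∫ z in (0 : ℝ)..1, green (t - s) x z * b (ev f s z))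
      + (∫ s in (0 : ℝ)..t, ∫ z in (0 : ℝ)..1, green (t - s) x z * σ (ev f s z) * h (s, z))

/-- `f` solves the skeleton equation of the spatial finite difference method with mesh size `1/n`
driven by `h`. -/
def IsDiscreteSkeletonSol {T : ℝ} (b σ u₀ v₀ : ℝ → ℝ) (n : ℕ) (h : L2OT T)
    (f : C(OT T, ℝ)) : Prop :=
  ∀ t ∈ Icc (0 : ℝ) T, ∀ x ∈ Icc (0 : ℝ) 1,
    ev f t x =
      (∫ z in (0 : ℝ)..1, greenD n t x z * v₀ (kappa n z))
      + (∫ z in (0 : ℝ)..1, deriv (fun τ : ℝ => greenD n τ x z) t * u₀ (kappa n z))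
      + (∫ s in (0 : ℝ)..t, ∫ z in (0 : ℝ)..1, greenD n (t - s) x z * b (ev f s (kappa n z)))
      + (∫ s in (0 : ℝ)..t, ∫ z in (0 : ℝ)..1,
          greenD n (t - s) x z * σ (ev f s (kappa n z)) * h (s, z))

/-- The solution map `Υ` sending `h` to the solution of the skeleton equation. -/
def Upsilon (T : ℝ) (b σ u₀ v₀ : ℝ → ℝ) (h : L2OT T) : C(OT T, ℝ) :=
  Classical.epsilon (IsSkeletonSol b σ u₀ v₀ h)

/-- The solution map `Υ^n` sending `h` to the solution of the discrete skeleton equation. -/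
def UpsilonD (T : ℝ) (b σ u₀ v₀ : ℝ → ℝ) (n : ℕ) (h : L2OT T) : C(OT T, ℝ) :=
  Classical.epsilon (IsDiscreteSkeletonSol b σ u₀ v₀ n h)

/-! ### The objective functionals -/

open Classical in
/-- For a map `S` from `L²` to the continuous functions: the functional equal to
`inf {‖h‖² / 2 : S h = f}` if `f (T, x₀) = y` and `f` is in the image of `S`, and to `+∞`
otherwise. -/
def objective {T : ℝ} (S : L2OT T → C(OT T, ℝ)) (x₀ y : ℝ) (f : C(OT T, ℝ)) : EReal :=
  if ev f T x₀ = y ∧ f ∈ range S then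
    ⨅ h ∈ {h : L2OT T | S h = f}, (((1 / 2 : ℝ) * ‖h‖ ^ 2 : ℝ) : EReal)
  else ⊤

/-- The functional `J_y`. -/
def J (T : ℝ) (b σ u₀ v₀ : ℝ → ℝ) (x₀ y : ℝ) : C(OT T, ℝ) → EReal :=
  objective (Upsilon T b σ u₀ v₀) x₀ y

/-- The functional `J^n_y`. -/
def JD (T : ℝ) (b σ u₀ v₀ : ℝ → ℝ) (x₀ : ℝ) (n : ℕ) (y : ℝ) : C(OT T, ℝ) → EReal :=
  objective (UpsilonD T b σ u₀ v₀ n) x₀ y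

end

end WaveGamma

/-! Both equations have the form `f p = init p + ⟪ker p, b (f ∘ node) + σ (f ∘ node) h⟫`, where
`ker` is a continuous map from the compact rectangle into `L²`. Everything rests on two facts about
such equations.

Uniform stability (`exists_unique_and_stable`): in the norm weighted by `exp (-r t)` the right-hand
side is a contraction. The rate `r` depends only on the Lipschitz constant, a bound for the kernel
and a bound for `‖h‖`. Solutions therefore exist and are unique, and the distance of any `g` to the
solution is at most a constant times the residual of `g`, uniformly in the mesh.

Compactness (`tendsto_pair`): pairing with a continuous kernel on a compact space turns bounded
weakly convergent sequences into uniformly convergent ones. Inserting the limit solution into the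
perturbed equations hence gives a vanishing residual, and solutions are continuous for weak
convergence of the control (`tendsto_solution`).

For the liminf inequality, controls of bounded energy have a weakly convergent subsequence, the
limit control drives the limit function, and the norm is weakly lower semicontinuous. The same
argument shows that the infimum defining the limit functional is attained by some `h`.

For the recovery sequence, the discrete solutions `v n` driven by this `h` converge to `f` but may
miss the condition at `(T, x₀)`. Adding `pair (D n).ker (a n • g)`, with `g` the nonzero limit
kernel at `(T, x₀)` and `a n → 0`, restores it. Since `σ` does not vanish, the corrected function is
again a solution, with a control that converges strongly to `h` (`exists_forcing_eq`).

It remains to check that the discrete data converge. In the sine basis the kernel coefficients are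
bounded by `1 / j` uniformly in the mesh, so the tails are small in `L²`, and every fixed mode
converges (`tendsto_greenDMap`). The initial position enters through a time derivative, which costs
one power of `j`. The loss is covered by the `1 / j ^ 2` decay of its discrete sine coefficients,
obtained from summation by parts (`abs_discrete_coef_le`). -/

namespace WaveGamma

noncomputable section

/-! ### Weak convergence in Hilbert spaces -/

section Hilbert

variable {E : Type*} [NormedAddCommGroup E] [InnerProductSpace ℝ E]

/-- Weak convergence in a real inner product space. -/
def WeakTendsto {ι : Type*} (u : ι → E) (l : Filter ι) (x : E) : Prop :=
  ∀ g : E, Tendsto (fun i => inner ℝ g (u i)) l (𝓝 (inner ℝ g x))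

lemma WeakTendsto.of_tendsto {ι : Type*} {u : ι → E} {l : Filter ι} {x : E}
    (h : Tendsto u l (𝓝 x)) : WeakTendsto u l x :=
  fun _ => tendsto_const_nhds.inner h

lemma WeakTendsto.add_tendsto_zero {ι : Type*} {u v : ι → E} {l : Filter ι} {x : E}
    (h : WeakTendsto u l x) (hv : Tendsto (fun i => v i - u i) l (𝓝 0)) : WeakTendsto v l x := by
  intro g
  have := (h g).add ((tendsto_const_nhds (x := g)).inner hv)
  simpa [← inner_add_right] using this

/-- Weak lower semicontinuity of the energy: test against `x` itself and use `⟪x, u⟫ ≤ (‖x‖² + ‖u‖²)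
/ 2` before passing to the limit. -/
lemma WeakTendsto.half_norm_sq_le {ι : Type*} {u : ι → E} {l : Filter ι} [NeBot l] {x : E}
    (h : WeakTendsto u l x) {c : ℝ} (hc : ∀ᶠ i in l, 1 / 2 * ‖u i‖ ^ 2 ≤ c) :
    1 / 2 * ‖x‖ ^ 2 ≤ c := by
  have h2 : inner ℝ x x ≤ 1 / 2 * ‖x‖ ^ 2 + c := by
    refine le_of_tendsto (h x) ?_
    filter_upwards [hc] with i hi
    nlinarith [real_inner_le_norm x (u i), sq_nonneg (‖x‖ - ‖u i‖)]
  rw [real_inner_self_eq_norm_sq] at h2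
  linarith

/-- Bounded sequences in a separable Hilbert space have weakly convergent subsequences. -/
lemma exists_weakTendsto_subseq [CompleteSpace E] [TopologicalSpace.SeparableSpace E]
    {u : ℕ → E} {M : ℝ} (hu : ∀ n, ‖u n‖ ≤ M) :
    ∃ (x : E) (φ : ℕ → ℕ), StrictMono φ ∧ WeakTendsto (u ∘ φ) atTop x := by
  -- The Riesz isomorphism transports the sequence to the dual, where sequential Banach–Alaoglu
  -- applies because `E` is separable.
  let v : ℕ → WeakDual ℝ E := fun n =>
    StrongDual.toWeakDual (InnerProductSpace.toDual ℝ E (u n))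
  have hv : ∀ n, v n ∈ WeakDual.toStrongDual ⁻¹' Metric.closedBall (0 : StrongDual ℝ E) M := by
    intro n
    simp only [mem_preimage, mem_closedBall_zero_iff]
    change ‖InnerProductSpace.toDual ℝ E (u n)‖ ≤ M
    simpa using hu n
  obtain ⟨a, -, φ, hφ, ha⟩ := WeakDual.isSeqCompact_closedBall ℝ E 0 M hv
  refine ⟨(InnerProductSpace.toDual ℝ E).symm (WeakDual.toStrongDual a), φ, hφ, fun g => ?_⟩
  have h1 : Tendsto (fun n => (v (φ n)) g) atTop (𝓝 (a g)) :=
    ((WeakDual.eval_continuous g).tendsto a).comp ha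
  have h2 : inner ℝ g ((InnerProductSpace.toDual ℝ E).symm (WeakDual.toStrongDual a)) = a g := by
    rw [real_inner_comm, InnerProductSpace.toDual_symm_apply]; rfl
  rw [h2]
  refine h1.congr fun n => ?_
  change inner ℝ (u (φ n)) g = _
  rw [real_inner_comm]; rfl

variable {X : Type*} [TopologicalSpace X]

/-- The continuous function `p ↦ ⟪k p, F⟫`. -/
def pair (k : C(X, E)) (F : E) : C(X, ℝ) := ⟨fun p => inner ℝ (k p) F, by fun_prop⟩

@[simp] lemma pair_apply (k : C(X, E)) (F : E) (p : X) : pair k F p = inner ℝ (k p) F := rfl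

variable [CompactSpace X]

lemma norm_pair_le (k : C(X, E)) (F : E) : ‖pair k F‖ ≤ ‖k‖ * ‖F‖ := by
  refine (ContinuousMap.norm_le _ (by positivity)).2 fun p => ?_
  refine (norm_inner_le_norm _ _).trans ?_
  gcongr
  exact k.norm_coe_le_norm p

/-- The range of `k` is compact, so a finite net reduces uniformity in `p` to finitely many scalar
limits. The error of the net is controlled by the bound on `‖u i‖`. -/
lemma tendsto_pair_of_weakTendsto_zero {ι : Type*} {l : Filter ι} (k : C(X, E)) {u : ι → E}
    {M : ℝ} (hM : ∀ᶠ i in l, ‖u i‖ ≤ M) (hu : WeakTendsto u l 0) :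
    Tendsto (fun i => pair k (u i)) l (𝓝 0) := by
  rw [tendsto_zero_iff_norm_tendsto_zero, Metric.tendsto_nhds]
  intro ε hε
  set M' := max M 0 + 1 with hM'
  have hM'0 : 0 < M' := by positivity
  obtain ⟨t, -, ht, hcov⟩ := (isCompact_range k.continuous).finite_cover_balls
    (e := ε / (4 * M')) (by positivity)
  have h1 : ∀ᶠ i in l, ∀ g ∈ t, |inner ℝ g (u i)| < ε / 4 := by
    rw [eventually_all_finite ht]
    intro g _
    have := (hu g)
    rw [inner_zero_right, Metric.tendsto_nhds] at this
    simpa using this (ε / 4) (by positivity)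
  filter_upwards [h1, hM] with i hi hMi
  rw [dist_zero_right, norm_norm]
  refine lt_of_le_of_lt ((ContinuousMap.norm_le _ (by positivity : 0 ≤ ε / 2)).2 fun p => ?_)
    (half_lt_self hε)
  obtain ⟨g, hg, hgp⟩ := mem_iUnion₂.1 (hcov (mem_range_self p))
  have e : inner ℝ (k p) (u i) = inner ℝ g (u i) + inner ℝ (k p - g) (u i) := by
    rw [← inner_add_left]; simp
  rw [pair_apply, Real.norm_eq_abs, e]
  have h3 : |inner ℝ (k p - g) (u i)| ≤ ε / (4 * M') * M' := by
    refine (abs_real_inner_le_norm _ _).trans ?_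
    gcongr
    · rw [← dist_eq_norm]; exact (Metric.mem_ball.1 hgp).le
    · rw [hM']; linarith [le_max_left M 0]
  have h4 : ε / (4 * M') * M' = ε / 4 := by field_simp
  have := hi g hg
  linarith [abs_add_le (inner ℝ g (u i)) (inner ℝ (k p - g) (u i))]

/-- Splits into `⟪k₀, u i - x⟫`, which vanishes by compactness, and `⟪k i - k₀, u i⟫`, which
vanishes by Cauchy–Schwarz and boundedness. -/
lemma tendsto_pair {ι : Type*} {l : Filter ι} {k : ι → C(X, E)} {k₀ : C(X, E)} {u : ι → E} {x : E}
    {M : ℝ} (hk : Tendsto k l (𝓝 k₀)) (hM : ∀ᶠ i in l, ‖u i‖ ≤ M) (hu : WeakTendsto u l x) :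
    Tendsto (fun i => pair (k i) (u i)) l (𝓝 (pair k₀ x)) := by
  have h1 : Tendsto (fun i => pair k₀ (u i - x)) l (𝓝 0) := by
    refine tendsto_pair_of_weakTendsto_zero (M := M + ‖x‖) k₀ ?_ fun g => ?_
    · filter_upwards [hM] with i hi
      exact (norm_sub_le _ _).trans (by gcongr)
    · simpa [inner_sub_right] using (hu g).sub_const (inner ℝ g x)
  have h2 : Tendsto (fun i => pair (k i - k₀) (u i)) l (𝓝 0) := by
    have h3 : Tendsto (fun i => ‖k i - k₀‖ * M) l (𝓝 0) := by
      simpa using (tendsto_iff_norm_sub_tendsto_zero.1 hk).mul_const M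
    refine squeeze_zero_norm' ?_ h3
    filter_upwards [hM] with i hi
    exact (norm_pair_le _ _).trans (by gcongr)
  have h4 := (h1.add h2).add_const (pair k₀ x)
  rw [zero_add, zero_add] at h4
  refine h4.congr fun i => ?_
  ext p
  simp [inner_sub_left, inner_sub_right]

end Hilbert

/-! ### Superposition operators on the space-time domain -/

section Superposition

variable {T : ℝ}

lemma measurableSet_OT (T : ℝ) : MeasurableSet (OT T) := measurableSet_Icc.prod measurableSet_Icc

instance instIsFiniteMeasureOT (T : ℝ) :
    IsFiniteMeasure ((volume : Measure (ℝ × ℝ)).restrict (OT T)) :=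
  ⟨by
    rw [Measure.restrict_apply_univ]
    exact (isCompact_Icc.prod isCompact_Icc).measure_lt_top⟩

lemma ev_coe (f : C(OT T, ℝ)) (p : OT T) : ev f p.1.1 p.1.2 = f p := by
  simp [ev, p.2]

lemma abs_ev_le (f : C(OT T, ℝ)) (t x : ℝ) : |ev f t x| ≤ ‖f‖ := by
  unfold ev
  split_ifs with h
  · exact f.norm_coe_le_norm _
  · simp

lemma ev_sub (f g : C(OT T, ℝ)) (t x : ℝ) : ev (f - g) t x = ev f t x - ev g t x := by
  unfold ev
  split_ifs <;> simp

lemma measurable_ev (f : C(OT T, ℝ)) : Measurable fun q : ℝ × ℝ => ev f q.1 q.2 := by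
  classical
  unfold ev
  exact Measurable.dite (f.continuous.measurable) measurable_const (measurableSet_OT T)

/-- The values of `f` at the nodes: `(s, z) ↦ f (s, κ z)`. -/
def nodeEv (κ : ℝ → ℝ) (f : C(OT T, ℝ)) (q : ℝ × ℝ) : ℝ := ev f q.1 (κ q.2)

lemma measurable_nodeEv {κ : ℝ → ℝ} (hκ : Measurable κ) (f : C(OT T, ℝ)) :
    Measurable (nodeEv κ f) :=
  (measurable_ev f).comp (measurable_fst.prodMk (hκ.comp measurable_snd))

lemma exists_bound_comp {φ : ℝ → ℝ} (hφ : Continuous φ) (R : ℝ) :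
    ∃ B, ∀ x, |x| ≤ R → |φ x| ≤ B := by
  obtain ⟨B, hB⟩ := (isCompact_Icc (a := -R) (b := R)).exists_bound_of_continuousOn hφ.continuousOn
  exact ⟨B, fun x hx => hB x (abs_le.1 hx)⟩

lemma memLp_comp_nodeEv {κ : ℝ → ℝ} (hκ : Measurable κ) {φ : ℝ → ℝ} (hφ : Continuous φ)
    (f : C(OT T, ℝ)) :
    MemLp (fun q => φ (nodeEv κ f q)) 2 ((volume : Measure (ℝ × ℝ)).restrict (OT T)) := by
  obtain ⟨B, hB⟩ := exists_bound_comp hφ ‖f‖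
  exact MemLp.of_bound (hφ.measurable.comp (measurable_nodeEv hκ f)).aestronglyMeasurable B
    (Eventually.of_forall fun q => hB _ (abs_ev_le f _ _))

lemma memLp_comp_nodeEv_mul {κ : ℝ → ℝ} (hκ : Measurable κ) {φ : ℝ → ℝ} (hφ : Continuous φ)
    (f : C(OT T, ℝ)) {h : ℝ × ℝ → ℝ} (hh : MemLp h 2 ((volume : Measure (ℝ × ℝ)).restrict (OT T))) :
    MemLp (fun q => φ (nodeEv κ f q) * h q) 2 ((volume : Measure (ℝ × ℝ)).restrict (OT T)) := by
  obtain ⟨B, hB⟩ := exists_bound_comp hφ ‖f‖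
  refine MemLp.of_le_mul (c := B) hh ((hφ.measurable.comp
    (measurable_nodeEv hκ f)).aestronglyMeasurable.mul hh.1) (Eventually.of_forall fun q => ?_)
  rw [norm_mul]
  gcongr
  exact hB _ (abs_ev_le f _ _)

lemma inner_eq_integral (F G : L2OT T) :
    inner ℝ F G = ∫ q in OT T, F q * G q := by
  rw [L2.inner_def]
  exact integral_congr_ae (Eventually.of_forall fun q => by simp [mul_comm])

/-- The element `1 + |h|` of `L²`. -/
def oneAdd (h : L2OT T) : L2OT T :=
  ((memLp_const (1 : ℝ)).add (Lp.memLp h).norm).toLp _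

lemma coeFn_oneAdd (h : L2OT T) :
    ∀ᵐ q ∂(volume : Measure (ℝ × ℝ)).restrict (OT T), oneAdd h q = 1 + |h q| := by
  filter_upwards [((memLp_const (1 : ℝ)).add (Lp.memLp h).norm).coeFn_toLp] with q hq
  exact hq

lemma norm_oneAdd_le (h : L2OT T) : ‖oneAdd h‖ ≤ ‖oneAdd (0 : L2OT T)‖ + ‖h‖ := by
  refine (norm_le_norm_add_norm_sub (oneAdd (0 : L2OT T)) (oneAdd h)).trans ?_
  gcongr
  refine Lp.norm_le_norm_of_ae_le ?_
  filter_upwards [Lp.coeFn_sub (oneAdd (0 : L2OT T)) (oneAdd h), coeFn_oneAdd h,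
    coeFn_oneAdd (0 : L2OT T), Lp.coeFn_zero ℝ 2 ((volume : Measure (ℝ × ℝ)).restrict (OT T))]
    with q h1 h2 h3 h4
  rw [h1, Pi.sub_apply, h2, h3, h4]
  simp

end Superposition

/-! ### The abstract skeleton equation -/

/-- The coefficients of an abstract skeleton equation
`f p = init p + ⟪ker p, b (f ∘ node) + σ (f ∘ node) h⟫`. -/
structure SkeletonData (T : ℝ) where
  /-- the kernel of the Duhamel term -/
  ker : C(OT T, L2OT T)
  /-- the contribution of the initial data -/
  init : C(OT T, ℝ)
  /-- the nodes at which the solution is evaluated -/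
  node : ℝ → ℝ
  measurable_node : Measurable node

/-- A causality and boundedness property of a Duhamel kernel in exponentially weighted norms. -/
def HasDecay {T : ℝ} (k : C(OT T, L2OT T)) (C : ℝ) : Prop :=
  ∀ r > 0, ∀ (p : OT T) (F H : L2OT T),
    (∀ᵐ q ∂(volume : Measure (ℝ × ℝ)).restrict (OT T), |F q| ≤ Real.exp (r * q.1) * |H q|) →
    |inner ℝ (k p) F| ≤ Real.exp (r * p.1.1) * (C / √(2 * r)) * ‖H‖

/-- `b` and `σ` are jointly Lipschitz. -/
structure LipCoef (b σ : ℝ → ℝ) (L : ℝ) : Prop where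
  pos : 0 < L
  le : ∀ x z : ℝ, |b x - b z| + |σ x - σ z| ≤ L * |x - z|

namespace LipCoef

variable {b σ : ℝ → ℝ} {L : ℝ} (hc : LipCoef b σ L)
include hc

lemma left (x z : ℝ) : |b x - b z| ≤ L * |x - z| :=
  le_trans (le_add_of_nonneg_right (abs_nonneg _)) (hc.le x z)

lemma right (x z : ℝ) : |σ x - σ z| ≤ L * |x - z| :=
  le_trans (le_add_of_nonneg_left (abs_nonneg _)) (hc.le x z)

lemma continuous_left : Continuous b :=
  (LipschitzWith.of_dist_le_mul (K := ⟨L, hc.pos.le⟩) fun x z => hc.left x z).continuous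

lemma continuous_right : Continuous σ :=
  (LipschitzWith.of_dist_le_mul (K := ⟨L, hc.pos.le⟩) fun x z => hc.right x z).continuous

/-- This is why the weight `oneAdd h = 1 + |h|` appears in all Lipschitz estimates of the forcing.
-/
lemma abs_add_mul_le (x z w : ℝ) :
    |(b x + σ x * w) - (b z + σ z * w)| ≤ L * |x - z| * (1 + |w|) := by
  have e : (b x + σ x * w) - (b z + σ z * w) = (b x - b z) + (σ x - σ z) * w := by ring
  rw [e]
  refine (abs_add_le _ _).trans ?_
  rw [abs_mul]
  have h1 := hc.le x z
  nlinarith [abs_nonneg (b x - b z), abs_nonneg (σ x - σ z), abs_nonneg w,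
    mul_nonneg (abs_nonneg (b x - b z)) (abs_nonneg w)]

end LipCoef

section Equation

variable {T : ℝ} {b σ : ℝ → ℝ} {L : ℝ}

/-- The function `b (f ∘ κ) + σ (f ∘ κ) h`. -/
def forcingFun (b σ κ : ℝ → ℝ) (h : ℝ × ℝ → ℝ) (f : C(OT T, ℝ)) (q : ℝ × ℝ) : ℝ :=
  b (nodeEv κ f q) + σ (nodeEv κ f q) * h q

lemma LipCoef.memLp_forcingFun (hc : LipCoef b σ L) {κ : ℝ → ℝ} (hκ : Measurable κ)
    (h : L2OT T) (f : C(OT T, ℝ)) :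
    MemLp (forcingFun b σ κ h f) 2 ((volume : Measure (ℝ × ℝ)).restrict (OT T)) :=
  (memLp_comp_nodeEv hκ hc.continuous_left f).add
    (memLp_comp_nodeEv_mul hκ hc.continuous_right f (Lp.memLp h))

/-- The forcing term `b (f ∘ κ) + σ (f ∘ κ) h` as an element of `L²`. -/
def forcing (hc : LipCoef b σ L) {κ : ℝ → ℝ} (hκ : Measurable κ) (h : L2OT T) (f : C(OT T, ℝ)) :
    L2OT T :=
  (hc.memLp_forcingFun hκ h f).toLp _

lemma coeFn_forcing (hc : LipCoef b σ L) {κ : ℝ → ℝ} (hκ : Measurable κ) (h : L2OT T)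
    (f : C(OT T, ℝ)) :
    forcing hc hκ h f =ᵐ[(volume : Measure (ℝ × ℝ)).restrict (OT T)] forcingFun b σ κ h f :=
  MemLp.coeFn_toLp _

lemma abs_forcing_sub_le (hc : LipCoef b σ L) {κ κ' : ℝ → ℝ} (hκ : Measurable κ)
    (hκ' : Measurable κ') (h : L2OT T) (f g : C(OT T, ℝ)) :
    ∀ᵐ q ∂(volume : Measure (ℝ × ℝ)).restrict (OT T),
      |(forcing hc hκ h f - forcing hc hκ' h g : L2OT T) q|
        ≤ L * |nodeEv κ f q - nodeEv κ' g q| * |oneAdd h q| := by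
  filter_upwards [coeFn_forcing hc hκ h f, coeFn_forcing hc hκ' h g,
    Lp.coeFn_sub (forcing hc hκ h f) (forcing hc hκ' h g), coeFn_oneAdd h] with q h1 h2 h3 h4
  rw [h3, Pi.sub_apply, h1, h2, h4, abs_of_nonneg (by positivity : 0 ≤ 1 + |h q|)]
  exact hc.abs_add_mul_le _ _ _

lemma norm_forcing_sub_le (hc : LipCoef b σ L) {κ κ' : ℝ → ℝ} (hκ : Measurable κ)
    (hκ' : Measurable κ') (h : L2OT T) (f g : C(OT T, ℝ)) {δ : ℝ}
    (hδ : ∀ q ∈ OT T, |nodeEv κ f q - nodeEv κ' g q| ≤ δ) :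
    ‖forcing hc hκ h f - forcing hc hκ' h g‖ ≤ L * δ * ‖oneAdd h‖ := by
  refine Lp.norm_le_mul_norm_of_ae_le_mul ?_
  filter_upwards [abs_forcing_sub_le hc hκ hκ' h f g, ae_restrict_mem (measurableSet_OT T)]
    with q h1 h2
  refine h1.trans ?_
  have := hc.pos
  rw [Real.norm_eq_abs]
  gcongr
  exact hδ q h2

/-- The right hand side of the abstract skeleton equation. -/
def SkeletonData.rhs (D : SkeletonData T) (hc : LipCoef b σ L) (h : L2OT T) (f : C(OT T, ℝ)) :
    C(OT T, ℝ) :=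
  D.init + pair D.ker (forcing hc D.measurable_node h f)

/-- The function `exp (r t)` on the space-time domain. -/
def expWeight (T r : ℝ) : C(OT T, ℝ) := ⟨fun p => Real.exp (r * p.1.1), by fun_prop⟩

@[simp] lemma expWeight_apply (r : ℝ) (p : OT T) : expWeight T r p = Real.exp (r * p.1.1) := rfl

lemma expWeight_mul_neg (r : ℝ) (f : C(OT T, ℝ)) :
    expWeight T r * (expWeight T (-r) * f) = f := by
  ext p
  simp [← mul_assoc, ← Real.exp_add]

lemma abs_nodeEv_expWeight_sub_le (κ : ℝ → ℝ) (r : ℝ) (f g : C(OT T, ℝ)) (q : ℝ × ℝ) :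
    |nodeEv κ (expWeight T r * f) q - nodeEv κ (expWeight T r * g) q|
      ≤ Real.exp (r * q.1) * ‖f - g‖ := by
  unfold nodeEv ev
  split_ifs with h
  · simp only [ContinuousMap.mul_apply, expWeight_apply, ← mul_sub, abs_mul, Real.abs_exp]
    gcongr
    exact (f - g).norm_coe_le_norm _
  · simp only [sub_self, abs_zero]; positivity

/-- Provides the weight that makes the contraction constant at most `1 / 2`; with this `r` one has
`√(2 r) ≥ 2 |A|`. -/
lemma exists_rate (A : ℝ) : ∃ r > 0, A / √(2 * r) ≤ 1 / 2 := by
  refine ⟨2 * A ^ 2 + 1, by positivity, ?_⟩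
  have h0 : 0 < √(2 * (2 * A ^ 2 + 1)) := by positivity
  rw [div_le_iff₀ h0]
  have : |2 * A| ≤ √(2 * (2 * A ^ 2 + 1)) := Real.abs_le_sqrt (by nlinarith)
  linarith [le_abs_self (2 * A)]

/-- The abstract skeleton equation has a unique solution, and the distance to it is controlled by
the residual, uniformly in the data. -/
theorem exists_unique_and_stable (hc : LipCoef b σ L) {C : ℝ} (hC : 0 ≤ C) (M : ℝ) :
    ∃ K, ∀ (D : SkeletonData T) (h : L2OT T), HasDecay D.ker C → ‖h‖ ≤ M →
      (∃! f, D.rhs hc h f = f) ∧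
      ∀ f g, D.rhs hc h f = f → ‖g - f‖ ≤ K * ‖g - D.rhs hc h g‖ := by
  have hL := hc.pos
  -- The argument bounds `√(2 r)` times the Lipschitz constant in the weighted norm. It involves
  -- only `C`, `L` and `M`, which makes `K` uniform over the data and the controls.
  obtain ⟨r, hr, hA⟩ := exists_rate (C * L * (‖oneAdd (0 : L2OT T)‖ + M))
  refine ⟨‖expWeight T r‖ * (2 * ‖expWeight T (-r)‖), fun D h hD hM => ?_⟩
  -- Conjugation by the weight replaces a change of norm: `Ψ` contracts the usual supremum norm, and
  -- its fixed points are the weighted solutions.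
  let Ψ : C(OT T, ℝ) → C(OT T, ℝ) := fun g => expWeight T (-r) * D.rhs hc h (expWeight T r * g)
  have hone : ‖oneAdd h‖ ≤ ‖oneAdd (0 : L2OT T)‖ + M := (norm_oneAdd_le h).trans (by gcongr)
  have hlip : ∀ g₁ g₂, dist (Ψ g₁) (Ψ g₂) ≤ ((1 / 2 : NNReal) : ℝ) * dist g₁ g₂ := by
    intro g₁ g₂
    rw [dist_eq_norm, dist_eq_norm]
    refine (ContinuousMap.norm_le _ (by positivity)).2 fun p => ?_
    set F := forcing hc D.measurable_node h (expWeight T r * g₁)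
      - forcing hc D.measurable_node h (expWeight T r * g₂) with hF
    have h1 : |inner ℝ (D.ker p) F| ≤ Real.exp (r * p.1.1) * (C / √(2 * r))
        * ‖(L * ‖g₁ - g₂‖) • oneAdd h‖ := by
      refine hD r hr p F _ ?_
      filter_upwards [abs_forcing_sub_le hc D.measurable_node D.measurable_node h
        (expWeight T r * g₁) (expWeight T r * g₂), Lp.coeFn_smul (L * ‖g₁ - g₂‖) (oneAdd h)]
        with q h2 h3
      refine h2.trans ?_
      rw [h3, Pi.smul_apply, smul_eq_mul, abs_mul, abs_of_nonneg (by positivity :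
        0 ≤ L * ‖g₁ - g₂‖)]
      have := abs_nodeEv_expWeight_sub_le D.node r g₁ g₂ q
      calc _ ≤ L * (Real.exp (r * q.1) * ‖g₁ - g₂‖) * |oneAdd h q| := by gcongr
        _ = _ := by ring
    have h2 : (Ψ g₁ - Ψ g₂) p = Real.exp (-(r * p.1.1)) * inner ℝ (D.ker p) F := by
      simp only [Ψ, SkeletonData.rhs, ContinuousMap.sub_apply, ContinuousMap.mul_apply,
        ContinuousMap.add_apply, pair_apply, expWeight_apply, hF, inner_sub_right]
      rw [neg_mul]; ring
    rw [h2, norm_mul, Real.norm_eq_abs, Real.abs_exp, Real.norm_eq_abs]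
    calc _ ≤ Real.exp (-(r * p.1.1)) * (Real.exp (r * p.1.1) * (C / √(2 * r))
        * ‖(L * ‖g₁ - g₂‖) • oneAdd h‖) := by gcongr
      _ = (Real.exp (-(r * p.1.1)) * Real.exp (r * p.1.1)) *
          (C * L * ‖oneAdd h‖ / √(2 * r) * ‖g₁ - g₂‖) := by
        rw [norm_smul, Real.norm_of_nonneg (by positivity)]; ring
      _ = C * L * ‖oneAdd h‖ / √(2 * r) * ‖g₁ - g₂‖ := by
        rw [← Real.exp_add]; simp
      _ ≤ C * L * (‖oneAdd (0 : L2OT T)‖ + M) / √(2 * r) * ‖g₁ - g₂‖ := by gcongr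
      _ ≤ 1 / 2 * ‖g₁ - g₂‖ := by gcongr
      _ = _ := by norm_num
  have hΨ : ContractingWith (1 / 2) Ψ :=
    ⟨by rw [← NNReal.coe_lt_coe]; norm_num, LipschitzWith.of_dist_le_mul hlip⟩
  have hfix : ∀ f, D.rhs hc h f = f → Function.IsFixedPt Ψ (expWeight T (-r) * f) := by
    intro f hf
    simp only [Function.IsFixedPt, Ψ]
    rw [expWeight_mul_neg, hf]
  have hstab : ∀ f g, D.rhs hc h f = f →
      ‖g - f‖ ≤ ‖expWeight T r‖ * (2 * ‖expWeight T (-r)‖) * ‖g - D.rhs hc h g‖ := by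
    intro f g hf
    -- The a posteriori estimate for contractions bounds the error by the residual divided by `1 - 1
    -- / 2`, hence the factor `2` in `K`.
    have h1 := hΨ.dist_le_of_fixedPoint (expWeight T (-r) * g) (hfix f hf)
    rw [dist_eq_norm, dist_eq_norm, ← mul_sub] at h1
    simp only [Ψ] at h1
    rw [expWeight_mul_neg, ← mul_sub] at h1
    have h3 : (1 - ((1 / 2 : NNReal) : ℝ)) = 1 / 2 := by norm_num
    rw [h3] at h1
    calc ‖g - f‖ = ‖expWeight T r * (expWeight T (-r) * (g - f))‖ := by rw [expWeight_mul_neg]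
      _ ≤ ‖expWeight T r‖ * ‖expWeight T (-r) * (g - f)‖ := norm_mul_le _ _
      _ ≤ ‖expWeight T r‖ * (‖expWeight T (-r) * (g - D.rhs hc h g)‖ / (1 / 2)) := by gcongr
      _ ≤ ‖expWeight T r‖ * (‖expWeight T (-r)‖ * ‖g - D.rhs hc h g‖ / (1 / 2)) := by
        gcongr; exact norm_mul_le _ _
      _ = _ := by ring
  refine ⟨⟨expWeight T r * hΨ.fixedPoint Ψ, ?_, fun f hf => ?_⟩, hstab⟩
  · have h1 : expWeight T (-r) * D.rhs hc h (expWeight T r * hΨ.fixedPoint Ψ)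
        = hΨ.fixedPoint Ψ := hΨ.fixedPoint_isFixedPt
    calc _ = expWeight T r * (expWeight T (-r) *
          D.rhs hc h (expWeight T r * hΨ.fixedPoint Ψ)) := (expWeight_mul_neg _ _).symm
      _ = _ := by rw [h1]
  · have h1 := hΨ.fixedPoint_unique (hfix f hf)
    rw [← h1, expWeight_mul_neg]

end Equation

/-! ### Stability of the abstract skeleton equation and Gamma-convergence -/

section Stability

variable {T : ℝ} {b σ : ℝ → ℝ} {L : ℝ} {ι : Type*} {l : Filter ι}

/-- Convergence of the coefficients of abstract skeleton equations. -/
structure DataTendsto (D : ι → SkeletonData T) (l : Filter ι) (D₀ : SkeletonData T) : Prop where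
  ker : Tendsto (fun i => (D i).ker) l (𝓝 D₀.ker)
  init : Tendsto (fun i => (D i).init) l (𝓝 D₀.init)
  node : ∀ f : C(OT T, ℝ), ∀ ε > 0, ∀ᶠ i in l, ∀ q ∈ OT T,
    |nodeEv (D i).node f q - nodeEv D₀.node f q| ≤ ε

lemma DataTendsto.const (D₀ : SkeletonData T) : DataTendsto (fun _ : ι => D₀) l D₀ where
  ker := tendsto_const_nhds
  init := tendsto_const_nhds
  node f ε hε := by simp [hε.le]

lemma DataTendsto.comp {D : ι → SkeletonData T} {D₀ : SkeletonData T} (hD : DataTendsto D l D₀)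
    {ι' : Type*} {l' : Filter ι'} {φ : ι' → ι} (hφ : Tendsto φ l' l) :
    DataTendsto (fun i => D (φ i)) l' D₀ where
  ker := hD.ker.comp hφ
  init := hD.init.comp hφ
  node f ε hε := hφ.eventually (hD.node f ε hε)

lemma coeFn_forcing_sub_forcing (hc : LipCoef b σ L) {κ : ℝ → ℝ} (hκ : Measurable κ)
    (h h' : L2OT T) (f : C(OT T, ℝ)) :
    ∀ᵐ q ∂(volume : Measure (ℝ × ℝ)).restrict (OT T),
      (forcing hc hκ h f - forcing hc hκ h' f : L2OT T) q
        = σ (nodeEv κ f q) * (h - h' : L2OT T) q := by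
  filter_upwards [coeFn_forcing hc hκ h f, coeFn_forcing hc hκ h' f,
    Lp.coeFn_sub (forcing hc hκ h f) (forcing hc hκ h' f), Lp.coeFn_sub h h'] with q h1 h2 h3 h4
  rw [h3, h4, Pi.sub_apply, Pi.sub_apply, h1, h2]
  simp only [forcingFun]; ring

/-- For fixed `f` the forcing is affine in the control, and multiplication by the bounded function
`σ (f ∘ κ)` can be moved to the test element. -/
lemma weakTendsto_forcing (hc : LipCoef b σ L) {κ : ℝ → ℝ} (hκ : Measurable κ)
    {h : ι → L2OT T} {h₀ : L2OT T} (hh : WeakTendsto h l h₀) (f : C(OT T, ℝ)) :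
    WeakTendsto (fun i => forcing hc hκ (h i) f) l (forcing hc hκ h₀ f) := by
  intro g
  have hm := memLp_comp_nodeEv_mul hκ hc.continuous_right f (Lp.memLp g)
  have key : ∀ i, inner ℝ g (forcing hc hκ (h i) f) =
      inner ℝ (hm.toLp _) (h i) - inner ℝ (hm.toLp _) h₀ + inner ℝ g (forcing hc hκ h₀ f) := by
    intro i
    rw [← inner_sub_right, ← sub_eq_iff_eq_add, ← inner_sub_right, inner_eq_integral,
      inner_eq_integral]
    refine integral_congr_ae ?_
    filter_upwards [coeFn_forcing_sub_forcing hc hκ (h i) h₀ f, hm.coeFn_toLp] with q h1 h2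
    rw [h1, h2]; ring
  have h1 := ((hh (hm.toLp _)).sub_const (inner ℝ (hm.toLp _) h₀)).add_const
    (inner ℝ g (forcing hc hκ h₀ f))
  rw [sub_self, zero_add] at h1
  exact h1.congr fun i => (key i).symm

lemma exists_norm_forcing_le (hc : LipCoef b σ L) {κ : ℝ → ℝ} (hκ : Measurable κ)
    (f : C(OT T, ℝ)) (M : ℝ) : ∃ B, ∀ h : L2OT T, ‖h‖ ≤ M → ‖forcing hc hκ h f‖ ≤ B := by
  obtain ⟨B, hB⟩ := exists_bound_comp hc.continuous_right ‖f‖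
  have hB0 : 0 ≤ B := (abs_nonneg _).trans (hB 0 (by simp))
  refine ⟨‖forcing hc hκ 0 f‖ + B * M, fun h hh => ?_⟩
  have h1 : ‖forcing hc hκ h f - forcing hc hκ 0 f‖ ≤ B * ‖h - 0‖ := by
    refine Lp.norm_le_mul_norm_of_ae_le_mul ?_
    filter_upwards [coeFn_forcing_sub_forcing hc hκ h 0 f] with q hq
    rw [hq, norm_mul]
    gcongr
    exact hB _ (abs_ev_le _ _ _)
  rw [sub_zero] at h1
  calc _ ≤ ‖forcing hc hκ 0 f‖ + ‖forcing hc hκ h f - forcing hc hκ 0 f‖ :=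
        norm_le_norm_add_norm_sub' _ _
    _ ≤ _ := by gcongr; exact h1.trans (by gcongr)

lemma tendsto_rhs (hc : LipCoef b σ L) {D : ι → SkeletonData T} {D₀ : SkeletonData T}
    (hD : DataTendsto D l D₀) {h : ι → L2OT T} {h₀ : L2OT T} {M : ℝ}
    (hM : ∀ᶠ i in l, ‖h i‖ ≤ M) (hh : WeakTendsto h l h₀) (f : C(OT T, ℝ)) :
    Tendsto (fun i => (D i).rhs hc (h i) f) l (𝓝 (D₀.rhs hc h₀ f)) := by
  have hL := hc.pos
  have hone : ∀ᶠ i in l, ‖oneAdd (h i)‖ ≤ ‖oneAdd (0 : L2OT T)‖ + M := by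
    filter_upwards [hM] with i hi using (norm_oneAdd_le _).trans (by gcongr)
  -- Moving the nodes changes the forcing by a term that is small in norm, uniformly over bounded
  -- controls, so weak convergence is needed only with the nodes of `D₀`.
  have h1 : Tendsto (fun i => forcing hc (D i).measurable_node (h i) f
      - forcing hc D₀.measurable_node (h i) f) l (𝓝 0) := by
    rw [tendsto_zero_iff_norm_tendsto_zero, Metric.tendsto_nhds]
    intro ε hε
    set R := |‖oneAdd (0 : L2OT T)‖ + M| + 1 with hR
    have hR0 : 0 < R := by positivity
    filter_upwards [hone, hD.node f (ε / (2 * L * R)) (by positivity)] with i hi hi'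
    rw [dist_zero_right, norm_norm]
    refine (norm_forcing_sub_le hc _ _ (h i) f f hi').trans_lt ?_
    calc _ ≤ L * (ε / (2 * L * R)) * R := by
          gcongr; rw [hR]; linarith [le_abs_self (‖oneAdd (0 : L2OT T)‖ + M)]
      _ = ε / 2 := by field_simp
      _ < ε := half_lt_self hε
  obtain ⟨B, hB⟩ := exists_norm_forcing_le hc D₀.measurable_node f M
  refine hD.init.add (tendsto_pair (M := B + 1) hD.ker ?_
    ((weakTendsto_forcing hc D₀.measurable_node hh f).add_tendsto_zero h1))
  filter_upwards [hM, (tendsto_zero_iff_norm_tendsto_zero.1 h1).eventually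
    (gt_mem_nhds one_pos)] with i hi hi'
  calc _ ≤ ‖forcing hc D₀.measurable_node (h i) f‖ + ‖forcing hc (D i).measurable_node (h i) f
      - forcing hc D₀.measurable_node (h i) f‖ := norm_le_norm_add_norm_sub' _ _
    _ ≤ _ := add_le_add (hB _ hi) hi'.le

/-- Solutions depend continuously on the data and, for the weak topology, on the control. -/
theorem tendsto_solution (hc : LipCoef b σ L) {D : ι → SkeletonData T} {D₀ : SkeletonData T}
    (hD : DataTendsto D l D₀) {C : ℝ} (hC : 0 ≤ C) (hdec : ∀ i, HasDecay (D i).ker C)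
    {h : ι → L2OT T} {h₀ : L2OT T} {M : ℝ} (hM : ∀ᶠ i in l, ‖h i‖ ≤ M) (hh : WeakTendsto h l h₀)
    {f : ι → C(OT T, ℝ)} {f₀ : C(OT T, ℝ)} (hf : ∀ i, (D i).rhs hc (h i) (f i) = f i)
    (hf₀ : D₀.rhs hc h₀ f₀ = f₀) : Tendsto f l (𝓝 f₀) := by
  obtain ⟨K, hK⟩ := exists_unique_and_stable (T := T) hc hC M
  have h1 := tendsto_rhs hc hD hM hh f₀
  -- The limit solution serves as an approximate solution of the perturbed equations. Only
  -- convergence of the right-hand sides at the single function `f₀` is needed, since stability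
  -- converts the residual into the error.
  rw [hf₀] at h1
  have h2 : Tendsto (fun i => K * ‖f₀ - (D i).rhs hc (h i) f₀‖) l (𝓝 0) := by
    have := ((tendsto_const_nhds (x := f₀)).sub h1).norm.const_mul K
    simpa using this
  rw [tendsto_iff_norm_sub_tendsto_zero]
  refine squeeze_zero' (Eventually.of_forall fun i => norm_nonneg _) ?_ h2
  filter_upwards [hM] with i hi
  rw [norm_sub_rev]
  exact (hK (D i) (h i) (hdec i) hi).2 (f i) f₀ (hf i)

/-- Dividing by `σ (u)` solves for the control: `h' = h + (forcing h f - forcing h u + g) / σ (u)`.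
If `f` solves the equation with control `h`, then adding the pairing with `g` to `f` yields a
solution with control `h'`, provided that the sum is `u`. -/
lemma exists_forcing_eq (hc : LipCoef b σ L) {κ : ℝ → ℝ} (hκ : Measurable κ) (h g : L2OT T)
    (f u : C(OT T, ℝ)) {m : ℝ} (hm : 0 < m) (hσ : ∀ x, |x| ≤ ‖u‖ → m ≤ |σ x|) :
    ∃ h' : L2OT T, forcing hc hκ h' u = forcing hc hκ h f + g ∧
      ‖h' - h‖ ≤ m⁻¹ * (L * ‖f - u‖ * ‖oneAdd h‖ + ‖g‖) := by
  set G := forcing hc hκ h f - forcing hc hκ h u + g with hG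
  have hbd : ∀ q, ‖(σ (nodeEv κ u q))⁻¹ * G q‖ ≤ m⁻¹ * ‖G q‖ := by
    intro q
    rw [norm_mul, norm_inv]
    gcongr
    exact hσ _ (abs_ev_le _ _ _)
  have hmem : MemLp (fun q => (σ (nodeEv κ u q))⁻¹ * G q) 2
      ((volume : Measure (ℝ × ℝ)).restrict (OT T)) :=
    MemLp.of_le_mul (Lp.memLp G) (((hc.continuous_right.measurable.comp
      (measurable_nodeEv hκ u)).inv.aestronglyMeasurable).mul (Lp.memLp G).1)
      (Eventually.of_forall hbd)
  refine ⟨h + hmem.toLp _, ?_, ?_⟩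
  · have : forcing hc hκ (h + hmem.toLp _) u - forcing hc hκ h u = G := by
      refine Lp.ext ?_
      filter_upwards [coeFn_forcing_sub_forcing hc hκ (h + hmem.toLp _) h u, hmem.coeFn_toLp]
        with q h1 h2
      rw [h1, add_sub_cancel_left, h2]
      have h3 : σ (nodeEv κ u q) ≠ 0 := by
        rw [← abs_pos]; exact hm.trans_le (hσ _ (abs_ev_le _ _ _))
      field_simp
    rw [sub_eq_iff_eq_add] at this
    rw [this, hG]; abel
  · rw [add_sub_cancel_left]
    have h1 : ‖hmem.toLp _‖ ≤ m⁻¹ * ‖G‖ := by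
      refine Lp.norm_le_mul_norm_of_ae_le_mul ?_
      filter_upwards [hmem.coeFn_toLp] with q hq
      rw [hq]; exact hbd q
    refine h1.trans ?_
    gcongr
    refine (norm_add_le _ _).trans ?_
    gcongr
    exact norm_forcing_sub_le hc hκ hκ h f u fun q _ => by
      unfold nodeEv
      rw [← ev_sub]
      exact abs_ev_le _ _ _

lemma exists_pos_le_abs (hc : LipCoef b σ L) (hσ : ∀ x, σ x ≠ 0) (R : ℝ) :
    ∃ m > 0, ∀ x, |x| ≤ R → m ≤ |σ x| := by
  obtain ⟨m, hm, h⟩ := (isCompact_Icc (a := -R) (b := R)).exists_forall_le'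
    (f := fun x => |σ x|) (a := 0) (hc.continuous_right.abs.continuousOn)
    fun x _ => abs_pos.2 (hσ x)
  exact ⟨m, hm, fun x hx => h x (abs_le.1 hx)⟩

lemma abs_sub_ev_le (f g : C(OT T, ℝ)) (t x : ℝ) : |ev f t x - ev g t x| ≤ ‖f - g‖ := by
  rw [← ev_sub]; exact abs_ev_le _ _ _

lemma tendsto_ev {f : ι → C(OT T, ℝ)} {f₀ : C(OT T, ℝ)} (hf : Tendsto f l (𝓝 f₀)) (t x : ℝ) :
    Tendsto (fun i => ev (f i) t x) l (𝓝 (ev f₀ t x)) := by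
  rw [tendsto_iff_norm_sub_tendsto_zero] at hf ⊢
  exact squeeze_zero (fun i => norm_nonneg _) (fun i => abs_sub_ev_le _ _ _ _) hf

lemma norm_le_of_half_norm_sq_le {E : Type*} [NormedAddCommGroup E] {x : E} {c : ℝ}
    (h : 1 / 2 * ‖x‖ ^ 2 ≤ c) : ‖x‖ ≤ √(2 * c) :=
  Real.le_sqrt_of_sq_le (by linarith)

lemma objective_le {S : L2OT T → C(OT T, ℝ)} {x₀ y : ℝ} {f : C(OT T, ℝ)} {h : L2OT T}
    (hy : ev f T x₀ = y) (hf : S h = f) :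
    objective S x₀ y f ≤ ((1 / 2 * ‖h‖ ^ 2 : ℝ) : EReal) := by
  rw [objective, if_pos ⟨hy, h, hf⟩]
  exact iInf₂_le h hf

lemma exists_of_objective_lt {S : L2OT T → C(OT T, ℝ)} {x₀ y : ℝ} {f : C(OT T, ℝ)} {c : ℝ}
    (hf : objective S x₀ y f < c) :
    ev f T x₀ = y ∧ ∃ h, S h = f ∧ 1 / 2 * ‖h‖ ^ 2 < c := by
  unfold objective at hf
  split_ifs at hf with h1
  · refine ⟨h1.1, ?_⟩
    simp only [iInf_lt_iff] at hf
    obtain ⟨h, hh, hlt⟩ := hf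
    exact ⟨h, hh, by exact_mod_cast hlt⟩
  · exact absurd hf (by simp)

/-- The key compactness property: limits of solutions with bounded controls are solutions. -/
lemma exists_solution_limit (hc : LipCoef b σ L) {D : ℕ → SkeletonData T} {D₀ : SkeletonData T}
    (hD : DataTendsto D atTop D₀) {C : ℝ} (hC : 0 ≤ C) (hdec : ∀ i, HasDecay (D i).ker C)
    (hdec₀ : HasDecay D₀.ker C) {h : ℕ → L2OT T} {c : ℕ → ℝ} {c₀ : ℝ}
    (hcc : Tendsto c atTop (𝓝 c₀)) (hh : ∀ i, 1 / 2 * ‖h i‖ ^ 2 ≤ c i)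
    {f : ℕ → C(OT T, ℝ)} {f₀ : C(OT T, ℝ)} (hf : ∀ i, (D i).rhs hc (h i) (f i) = f i)
    (hff : Tendsto f atTop (𝓝 f₀)) :
    ∃ h₀ : L2OT T, D₀.rhs hc h₀ f₀ = f₀ ∧ 1 / 2 * ‖h₀‖ ^ 2 ≤ c₀ := by
  obtain ⟨B, hB⟩ := hcc.bddAbove_range
  have hM : ∀ i, ‖h i‖ ≤ √(2 * B) := fun i =>
    norm_le_of_half_norm_sq_le ((hh i).trans (hB (mem_range_self i)))
  have : Fact ((2 : ENNReal) ≠ ⊤) := ⟨by simp⟩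
  obtain ⟨h₀, φ, hφ, hw⟩ := exists_weakTendsto_subseq hM
  obtain ⟨K, hK⟩ := exists_unique_and_stable (T := T) hc hC ‖h₀‖
  obtain ⟨f', hf', -⟩ := (hK D₀ h₀ hdec₀ le_rfl).1
  have h1 := tendsto_solution hc (hD.comp hφ.tendsto_atTop) hC (fun i => hdec (φ i))
    (Eventually.of_forall fun i => hM (φ i)) hw (fun i => hf (φ i)) hf'
  have h2 : f' = f₀ := tendsto_nhds_unique h1 (hff.comp hφ.tendsto_atTop)
  -- The energy bounds `c i` converge but need not be constant, so lower semicontinuity is applied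
  -- at level `c₀ + ε`.
  refine ⟨h₀, h2 ▸ hf', le_of_forall_pos_le_add fun ε hε => hw.half_norm_sq_le ?_⟩
  filter_upwards [(hcc.comp hφ.tendsto_atTop).eventually
    (gt_mem_nhds (lt_add_of_pos_right c₀ hε))] with i hi
  exact (hh (φ i)).trans hi.le

/-- Gamma-convergence of the objective functionals of a convergent family of abstract skeleton
equations. -/
theorem gammaConverges_objective (hc : LipCoef b σ L) (hσ : ∀ x, σ x ≠ 0)
    {D : ℕ+ → SkeletonData T} {D₀ : SkeletonData T} (hD : DataTendsto D atTop D₀)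
    {C : ℝ} (hC : 0 ≤ C) (hdec : ∀ i, HasDecay (D i).ker C) (hdec₀ : HasDecay D₀.ker C)
    {S : ℕ+ → L2OT T → C(OT T, ℝ)} {S₀ : L2OT T → C(OT T, ℝ)}
    (hS : ∀ n h f, S n h = f ↔ (D n).rhs hc h f = f) (hS₀ : ∀ h f, S₀ h = f ↔ D₀.rhs hc h f = f)
    {x₀ : ℝ} (hx₀ : (T, x₀) ∈ OT T) (hker : D₀.ker ⟨(T, x₀), hx₀⟩ ≠ 0) (y : ℝ) :
    GammaConverges (fun n => objective (S n) x₀ y) (objective S₀ x₀ y) := by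
  have hL := hc.pos
  refine ⟨fun f u hu => ?_, fun f => ?_⟩
  · by_contra hlt
    rw [not_le] at hlt
    -- If the inequality fails, a real level `c` strictly in between is undercut infinitely often.
    -- This gives controls of energy below `c` along a subsequence, and their weak limit contradicts
    -- the choice of `c`.
    obtain ⟨c, hc1, hc2⟩ := EReal.lt_iff_exists_real_btwn.1 hlt
    obtain ⟨φ, hφ, hφc⟩ := exists_seq_forall_of_frequently
      (frequently_lt_of_liminf_lt (by isBoundedDefault) hc1)
    choose hy h hSh hn using fun m => exists_of_objective_lt (hφc m)
    obtain ⟨h₀, hh₀, hle⟩ := exists_solution_limit hc (hD.comp hφ) hC (fun i => hdec _) hdec₀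
      (tendsto_const_nhds (x := c)) (fun i => (hn i).le) (fun i => (hS _ _ _).1 (hSh i))
      (hu.comp hφ)
    have hyf : ev f T x₀ = y := by
      refine tendsto_nhds_unique (tendsto_ev (hu.comp hφ) T x₀) ?_
      exact tendsto_const_nhds.congr fun m => (hy m).symm
    have h3 := objective_le hyf ((hS₀ _ _).2 hh₀)
    exact absurd (hc2.trans_le h3) (not_lt.2 (by exact_mod_cast hle))
  · rcases eq_or_ne (objective S₀ x₀ y f) ⊤ with htop | htop
    · exact ⟨fun _ => f, tendsto_const_nhds, by rw [htop]; exact le_top⟩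
    have hbot : 0 ≤ objective S₀ x₀ y f := by
      unfold objective
      split_ifs
      · exact le_iInf₂ fun h _ => by exact_mod_cast (by positivity : (0 : ℝ) ≤ 1 / 2 * ‖h‖ ^ 2)
      · exact le_top
    obtain ⟨c, hcJ⟩ : ∃ c : ℝ, objective S₀ x₀ y f = c :=
      ⟨_, (EReal.coe_toReal htop (ne_bot_of_le_ne_bot (by simp) hbot)).symm⟩
    have hex : ∀ m : ℕ, objective S₀ x₀ y f < ((c + 1 / ((m : ℝ) + 1) : ℝ) : EReal) := by
      intro m
      rw [hcJ]
      exact_mod_cast lt_add_of_pos_right c (by positivity)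
    choose hy hm hSm hnm using fun m => exists_of_objective_lt (hex m)
    have hlim : Tendsto (fun m : ℕ => c + 1 / ((m : ℝ) + 1)) atTop (𝓝 c) := by
      simpa using tendsto_const_nhds.add (tendsto_one_div_add_atTop_nhds_zero_nat (𝕜 := ℝ))
    -- Attainment of the infimum: the compactness property is applied to constant data and a
    -- minimizing sequence for the fixed function `f`.
    obtain ⟨h, hh, hle⟩ := exists_solution_limit hc (DataTendsto.const (l := atTop) D₀) hC
      (fun _ => hdec₀) hdec₀ hlim (fun i => (hnm i).le) (fun i => (hS₀ _ _).1 (hSm i))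
      (tendsto_const_nhds (x := f))
    have hy0 : ev f T x₀ = y := hy 0
    set p₀ : OT T := ⟨(T, x₀), hx₀⟩ with hp₀
    -- the discrete solutions driven by the optimal control
    let v : ℕ+ → C(OT T, ℝ) := fun n => S n h
    have hv : ∀ n, (D n).rhs hc h (v n) = v n := fun n => (hS n h _).1 rfl
    have hvf : Tendsto v atTop (𝓝 f) := tendsto_solution hc hD hC hdec (M := ‖h‖)
      (Eventually.of_forall fun _ => le_rfl) (WeakTendsto.of_tendsto tendsto_const_nhds) hv hh
    -- a correction steering them to the target
    set g := D₀.ker p₀ with hg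
    have hpair : Tendsto (fun n => inner ℝ ((D n).ker p₀) g) atTop (𝓝 (inner ℝ g g)) :=
      (((ContinuousEvalConst.continuous_eval_const p₀).tendsto _).comp hD.ker).inner
        tendsto_const_nhds
    have hgg : inner ℝ g g ≠ 0 := inner_self_ne_zero.2 hker
    -- Chosen so that the correction at `(T, x₀)` equals the defect `y - ev (v n) T x₀`. The
    -- denominator tends to `‖g‖² ≠ 0`, so it is nonzero for large `n`.
    let a : ℕ+ → ℝ := fun n => (y - ev (v n) T x₀) / inner ℝ ((D n).ker p₀) g
    have ha : Tendsto a atTop (𝓝 0) := by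
      have h1 := (tendsto_const_nhds (x := y)).sub (tendsto_ev hvf T x₀)
      rw [hy0, sub_self] at h1
      have h2 := h1.div hpair hgg
      rwa [zero_div] at h2
    let u : ℕ+ → C(OT T, ℝ) := fun n => v n + pair (D n).ker (a n • g)
    have hag : Tendsto (fun n => a n • g) atTop (𝓝 0) := by
      simpa using ha.smul_const g
    have huv : Tendsto (fun n => pair (D n).ker (a n • g)) atTop (𝓝 0) := by
      have h1 : Tendsto (fun n => ‖(D n).ker‖ * ‖a n • g‖) atTop (𝓝 0) := by
        simpa using hD.ker.norm.mul hag.norm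
      exact squeeze_zero_norm (fun n => norm_pair_le _ _) h1
    have huf : Tendsto u atTop (𝓝 f) := by simpa using hvf.add huv
    have huy : ∀ᶠ n in atTop, ev (u n) T x₀ = y := by
      filter_upwards [hpair.eventually_ne hgg] with n hn
      have h1 : ev (u n) T x₀ = ev (v n) T x₀ + a n * inner ℝ ((D n).ker p₀) g := by
        have e1 := ev_coe (u n) p₀
        have e2 := ev_coe (v n) p₀
        simp only [hp₀] at e1 e2 ⊢
        rw [e1, e2]
        simp [u, inner_smul_right]
      rw [h1]
      simp only [a]
      field_simp
      ring
    obtain ⟨m, hm0, hmσ⟩ := exists_pos_le_abs hc hσ (‖f‖ + 1)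
    have hun : ∀ᶠ n in atTop, ‖u n‖ ≤ ‖f‖ + 1 := by
      filter_upwards [huf.norm.eventually (gt_mem_nhds (lt_add_one ‖f‖))] with n hn using hn.le
    have hctrl : ∀ n, ∃ h' : L2OT T, ‖u n‖ ≤ ‖f‖ + 1 → S n h' = u n ∧
        ‖h' - h‖ ≤ m⁻¹ * (L * ‖v n - u n‖ * ‖oneAdd h‖ + ‖a n • g‖) := by
      intro n
      -- The lower bound `m` for `|σ|` holds only on this range. The bound on `‖u n‖` holds
      -- eventually, so the dummy control `0` used otherwise has no effect on the limit.
      by_cases hn : ‖u n‖ ≤ ‖f‖ + 1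
      · obtain ⟨h', h1, h2⟩ := exists_forcing_eq hc (D n).measurable_node h (a n • g) (v n) (u n)
          hm0 fun x hx => hmσ x (hx.trans hn)
        refine ⟨h', fun _ => ⟨(hS _ _ _).2 ?_, h2⟩⟩
        rw [SkeletonData.rhs, h1]
        simp only [u]
        -- Only the free-standing `v n` is expanded by its equation; the one inside the forcing must
        -- stay.
        nth_rewrite 2 [← hv n]
        rw [SkeletonData.rhs, add_assoc]
        congr 1
        ext p
        simp [inner_add_right]
      · exact ⟨0, fun h => absurd h hn⟩
    choose h' hh' using hctrl
    have hlim' : Tendsto h' atTop (𝓝 h) := by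
      rw [tendsto_iff_norm_sub_tendsto_zero]
      have h1 : Tendsto (fun n => m⁻¹ * (L * ‖v n - u n‖ * ‖oneAdd h‖ + ‖a n • g‖)) atTop (𝓝 0) := by
        have h2 : Tendsto (fun n => ‖v n - u n‖) atTop (𝓝 0) := by
          simpa using (hvf.sub huf).norm
        simpa using ((((h2.const_mul L).mul_const ‖oneAdd h‖).add hag.norm).const_mul m⁻¹)
      refine squeeze_zero' (Eventually.of_forall fun _ => norm_nonneg _) ?_ h1
      filter_upwards [hun] with n hn using (hh' n hn).2
    refine ⟨u, huf, ?_⟩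
    have h1 : Tendsto (fun n => ((1 / 2 * ‖h' n‖ ^ 2 : ℝ) : EReal)) atTop
        (𝓝 ((1 / 2 * ‖h‖ ^ 2 : ℝ) : EReal)) :=
      (continuous_coe_real_ereal.tendsto _).comp ((hlim'.norm.pow 2).const_mul (1 / 2))
    calc limsup (fun n => objective (S n) x₀ y (u n)) atTop
        ≤ limsup (fun n => ((1 / 2 * ‖h' n‖ ^ 2 : ℝ) : EReal)) atTop := by
          refine limsup_le_limsup ?_
          filter_upwards [hun, huy] with n hn hn'
          exact objective_le hn' (hh' n hn).1
      _ = ((1 / 2 * ‖h‖ ^ 2 : ℝ) : EReal) := h1.limsup_eq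
      _ ≤ objective S₀ x₀ y f := by rw [hcJ]; exact_mod_cast hle

end Stability

/-! ### Duhamel kernels from pointwise kernels -/

section Duhamel

/-- Square integrable functions on `[0,1]`. -/
abbrev L2I : Type := Lp ℝ 2 ((volume : Measure ℝ).restrict (Icc (0 : ℝ) 1))

variable {T : ℝ}

lemma restrict_OT (T : ℝ) : (volume : Measure (ℝ × ℝ)).restrict (OT T)
    = ((volume : Measure ℝ).restrict (Icc 0 T)).prod ((volume : Measure ℝ).restrict (Icc 0 1)) := by
  rw [Measure.prod_restrict, ← Measure.volume_eq_prod, OT]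

lemma eLpNorm_two_sq {α : Type*} [MeasurableSpace α] (μ : Measure α) (f : α → ℝ) :
    eLpNorm f 2 μ ^ 2 = ∫⁻ a, ‖f a‖ₑ ^ 2 ∂μ := by
  have h := eLpNorm_nnreal_pow_eq_lintegral (f := f) (μ := μ) (p := 2) (by norm_num)
  simpa using h

lemma eLpNorm_le_of_sq_le {α : Type*} [MeasurableSpace α] {μ : Measure α} {f : α → ℝ} {c : ℝ}
    (hc : 0 ≤ c) (h : ∫⁻ a, ‖f a‖ₑ ^ 2 ∂μ ≤ ENNReal.ofReal (c ^ 2)) :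
    eLpNorm f 2 μ ≤ ENNReal.ofReal c := by
  rw [← eLpNorm_two_sq, ENNReal.ofReal_pow hc] at h
  exact (ENNReal.pow_right_strictMono two_ne_zero).le_iff_le.1 h

/-- An `L²` bound on the space-time domain from bounds on the time slices. -/
lemma eLpNorm_le_of_slices {F : ℝ × ℝ → ℝ} (hF : Measurable F) {c : ℝ → ℝ} (hc : Measurable c)
    (hc0 : ∀ s, 0 ≤ c s)
    (h : ∀ s ∈ Icc 0 T, eLpNorm (fun z => F (s, z)) 2 ((volume : Measure ℝ).restrict (Icc 0 1))
      ≤ ENNReal.ofReal (c s)) {A : ℝ} (hA : 0 ≤ A)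
    (hcA : ∫⁻ s in Icc 0 T, ENNReal.ofReal (c s ^ 2) ≤ ENNReal.ofReal (A ^ 2)) :
    eLpNorm F 2 ((volume : Measure (ℝ × ℝ)).restrict (OT T)) ≤ ENNReal.ofReal A := by
  refine eLpNorm_le_of_sq_le hA (le_trans ?_ hcA)
  rw [restrict_OT, lintegral_prod _ (by fun_prop)]
  refine setLIntegral_mono (by fun_prop) fun s hs => ?_
  rw [← eLpNorm_two_sq (f := fun z => F (s, z)), ENNReal.ofReal_pow (hc0 s)]
  gcongr
  exact h s hs

/-- `k` is a jointly measurable kernel vanishing at time zero whose slices are the values of a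
continuous map into `L²(0,1)`. -/
structure Represents (k : ℝ → ℝ → ℝ → ℝ) (W : C(OT T, L2I)) : Prop where
  measurable : ∀ x, Measurable fun q : ℝ × ℝ => k q.1 x q.2
  zero : ∀ x z, k 0 x z = 0
  ae : ∀ p : OT T, W p =ᵐ[(volume : Measure ℝ).restrict (Icc 0 1)] k p.1.1 p.1.2

/-- The function `(s, z) ↦ k (t - s) x z`, extended by zero for `s > t`. -/
def duhamelFun (k : ℝ → ℝ → ℝ → ℝ) (p : ℝ × ℝ) (q : ℝ × ℝ) : ℝ := k (max (p.1 - q.1) 0) p.2 q.2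

lemma lag_mem {p : OT T} {s : ℝ} (hs : s ∈ Icc 0 T) : (max (p.1.1 - s) 0, p.1.2) ∈ OT T := by
  have h := p.2
  simp only [OT, mem_prod, mem_Icc] at h hs ⊢
  refine ⟨⟨le_max_right _ _, max_le (by linarith) (by linarith)⟩, h.2⟩

/-- The point `((t - s)⁺, x)`. -/
def lag (p : OT T) {s : ℝ} (hs : s ∈ Icc 0 T) : OT T := ⟨_, lag_mem (p := p) hs⟩

/-- With `s` fixed, passing to the lagged point is nonexpansive. Uniform continuity of `W` therefore
controls all time slices of the Duhamel kernel at once. -/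
lemma dist_lag_le (p p' : OT T) {s : ℝ} (hs : s ∈ Icc 0 T) :
    dist (lag p hs) (lag p' hs) ≤ dist p p' := by
  simp only [lag, Subtype.dist_eq, Prod.dist_eq]
  refine max_le_max ?_ le_rfl
  rw [Real.dist_eq, Real.dist_eq]
  refine (abs_max_sub_max_le_abs _ _ _).trans (by simp)

namespace Represents

variable {k k' : ℝ → ℝ → ℝ → ℝ} {W W' : C(OT T, L2I)}

lemma measurable_duhamelFun (hk : Represents k W) (p : ℝ × ℝ) : Measurable (duhamelFun k p) :=
  (hk.measurable p.2).comp (((measurable_const.sub measurable_fst).max measurable_const).prodMk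
    measurable_snd)

lemma eLpNorm_slice_sub_le (hk : Represents k W) (hk' : Represents k' W') (p p' : OT T) {s : ℝ}
    (hs : s ∈ Icc 0 T) :
    eLpNorm (fun z => duhamelFun k p (s, z) - duhamelFun k' p' (s, z)) 2
      ((volume : Measure ℝ).restrict (Icc 0 1))
      ≤ ENNReal.ofReal ‖W (lag p hs) - W' (lag p' hs)‖ := by
  rw [Lp.norm_def, ENNReal.ofReal_toReal (Lp.eLpNorm_ne_top _)]
  refine (eLpNorm_congr_ae ?_).le
  filter_upwards [hk.ae (lag p hs), hk'.ae (lag p' hs),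
    Lp.coeFn_sub (W (lag p hs)) (W' (lag p' hs))] with z h1 h2 h3
  rw [h3, Pi.sub_apply, h1, h2]
  rfl

lemma eLpNorm_slice_le (hk : Represents k W) (p : OT T) {s : ℝ} (hs : s ∈ Icc 0 T) :
    eLpNorm (fun z => duhamelFun k p (s, z)) 2 ((volume : Measure ℝ).restrict (Icc 0 1))
      ≤ ENNReal.ofReal ‖W (lag p hs)‖ := by
  rw [Lp.norm_def, ENNReal.ofReal_toReal (Lp.eLpNorm_ne_top _)]
  refine (eLpNorm_congr_ae ?_).le
  filter_upwards [hk.ae (lag p hs)] with z h1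
  rw [h1]
  rfl

lemma eLpNorm_duhamelFun_sub_le (hT : 0 ≤ T) (hk : Represents k W) (hk' : Represents k' W')
    (p p' : OT T) {c : ℝ} (hc : 0 ≤ c)
    (h : ∀ s (hs : s ∈ Icc 0 T), ‖W (lag p hs) - W' (lag p' hs)‖ ≤ c) :
    eLpNorm (duhamelFun k p - duhamelFun k' p') 2 ((volume : Measure (ℝ × ℝ)).restrict (OT T))
      ≤ ENNReal.ofReal (√T * c) := by
  refine eLpNorm_le_of_slices (c := fun _ => c)
    ((hk.measurable_duhamelFun _).sub (hk'.measurable_duhamelFun _)) measurable_const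
    (fun _ => hc) (fun s hs => ?_) (by positivity) ?_
  · exact (hk.eLpNorm_slice_sub_le hk' p p' hs).trans (ENNReal.ofReal_le_ofReal (h s hs))
  · rw [setLIntegral_const, Real.volume_Icc, sub_zero, mul_pow, Real.sq_sqrt hT,
      ← ENNReal.ofReal_mul (by positivity), mul_comm]

lemma memLp_duhamelFun (hT : 0 ≤ T) (hk : Represents k W) (p : OT T) :
    MemLp (duhamelFun k p) 2 ((volume : Measure (ℝ × ℝ)).restrict (OT T)) := by
  refine ⟨(hk.measurable_duhamelFun _).aestronglyMeasurable, lt_of_le_of_lt ?_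
    (ENNReal.ofReal_lt_top (r := √T * ‖W‖))⟩
  refine eLpNorm_le_of_slices (c := fun _ => ‖W‖) (hk.measurable_duhamelFun _) measurable_const
    (fun _ => norm_nonneg _) (fun s hs => ?_) (by positivity) ?_
  · exact (hk.eLpNorm_slice_le p hs).trans (ENNReal.ofReal_le_ofReal (W.norm_coe_le_norm _))
  · rw [setLIntegral_const, Real.volume_Icc, sub_zero, mul_pow, Real.sq_sqrt hT,
      ← ENNReal.ofReal_mul (by positivity), mul_comm]

lemma norm_toLp_sub_le (hT : 0 ≤ T) (hk : Represents k W) (hk' : Represents k' W')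
    (p p' : OT T) {c : ℝ} (hc : 0 ≤ c)
    (h : ∀ s (hs : s ∈ Icc 0 T), ‖W (lag p hs) - W' (lag p' hs)‖ ≤ c) :
    ‖(hk.memLp_duhamelFun hT p).toLp _ - (hk'.memLp_duhamelFun hT p').toLp _‖ ≤ √T * c := by
  rw [← MemLp.toLp_sub, Lp.norm_toLp]
  exact ENNReal.toReal_le_of_le_ofReal (by positivity)
    (hk.eLpNorm_duhamelFun_sub_le hT hk' p p' hc h)

/-- The Duhamel kernel as a continuous map into `L²`. -/
def ker (hT : 0 ≤ T) (hk : Represents k W) : C(OT T, L2OT T) where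
  toFun p := (hk.memLp_duhamelFun hT p).toLp _
  continuous_toFun := by
    rw [Metric.continuous_iff]
    intro p ε hε
    have hu := CompactSpace.uniformContinuous_of_continuous W.continuous
    obtain ⟨δ, hδ, h⟩ := Metric.uniformContinuous_iff.1 hu (ε / (√T + 1)) (by positivity)
    refine ⟨δ, hδ, fun p' hp' => ?_⟩
    rw [dist_eq_norm]
    refine (hk.norm_toLp_sub_le hT hk p' p (c := ε / (√T + 1)) (by positivity)
      fun s hs => ?_).trans_lt ?_
    · rw [← dist_eq_norm]
      exact (h ((dist_lag_le p' p hs).trans_lt hp')).le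
    · rw [← mul_div_assoc, div_lt_iff₀ (by positivity)]
      nlinarith

lemma coeFn_ker (hT : 0 ≤ T) (hk : Represents k W) (p : OT T) :
    hk.ker hT p =ᵐ[(volume : Measure (ℝ × ℝ)).restrict (OT T)] duhamelFun k p :=
  (hk.memLp_duhamelFun hT p).coeFn_toLp

lemma norm_ker_sub_le (hT : 0 ≤ T) (hk : Represents k W) (hk' : Represents k' W') :
    ‖hk.ker hT - hk'.ker hT‖ ≤ √T * ‖W - W'‖ :=
  (ContinuousMap.norm_le _ (by positivity)).2 fun p =>
    hk.norm_toLp_sub_le hT hk' p p (norm_nonneg _) fun _ _ => (W - W').norm_coe_le_norm _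

lemma duhamelFun_eq_zero (hk : Represents k W) {p q : ℝ × ℝ} (h : p.1 ≤ q.1) :
    duhamelFun k p q = 0 := by
  unfold duhamelFun
  rw [max_eq_right (by linarith), hk.zero]

/-- Integrating down to `-∞` instead of `0` gives the closed form, and this is the origin of the
gain `1 / √(2 r)`. -/
lemma lintegral_exp_le {r t : ℝ} (hr : 0 < r) :
    ∫⁻ s in Icc 0 T, ENNReal.ofReal ((if s < t then Real.exp (r * s) else 0) ^ 2)
      ≤ ENNReal.ofReal (Real.exp (2 * r * t) / (2 * r)) := by
  calc _ ≤ ∫⁻ s, ENNReal.ofReal ((if s < t then Real.exp (r * s) else 0) ^ 2) :=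
        setLIntegral_le_lintegral _ _
    _ ≤ ∫⁻ s, (Iic t).indicator (fun s => ENNReal.ofReal (Real.exp (2 * r * s))) s := by
        refine lintegral_mono fun s => ?_
        by_cases h : s < t
        · rw [if_pos h, indicator_of_mem (mem_Iic.2 h.le), ← Real.exp_nat_mul]
          refine le_of_eq ?_
          push_cast; ring_nf
        · simp [h]
    _ = ∫⁻ s in Iic t, ENNReal.ofReal (Real.exp (2 * r * s)) :=
        lintegral_indicator measurableSet_Iic _
    _ = ENNReal.ofReal (∫ s in Iic t, Real.exp (2 * r * s)) :=
        (ofReal_integral_eq_lintegral_ofReal (integrableOn_exp_mul_Iic (by positivity) t)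
          (Eventually.of_forall fun s => (Real.exp_pos _).le)).symm
    _ ≤ _ := by rw [integral_exp_mul_Iic (by positivity)]

/-- Move the weight `exp (r s)` onto the kernel and apply Cauchy–Schwarz. Causality confines the
kernel to `s < t`, so its weighted norm is at most `C exp (r t) / √(2 r)`. -/
lemma hasDecay (hT : 0 ≤ T) (hk : Represents k W) {C : ℝ} (hC : ‖W‖ ≤ C) :
    HasDecay (hk.ker hT) C := by
  intro r hr p F H hFH
  have hC0 : 0 ≤ C := (norm_nonneg _).trans hC
  set A := Real.exp (r * p.1.1) * (C / √(2 * r)) with hA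
  have hA0 : 0 ≤ A := by positivity
  have hmeas : Measurable fun q : ℝ × ℝ => Real.exp (r * q.1) * duhamelFun k p q :=
    (by fun_prop : Measurable fun q : ℝ × ℝ => Real.exp (r * q.1)).mul
      (hk.measurable_duhamelFun _)
  have hnorm : eLpNorm (fun q : ℝ × ℝ => Real.exp (r * q.1) * duhamelFun k p q) 2
      ((volume : Measure (ℝ × ℝ)).restrict (OT T)) ≤ ENNReal.ofReal A := by
    refine eLpNorm_le_of_slices (c := fun s => C * if s < p.1.1 then Real.exp (r * s) else 0)
      hmeas ?_ (fun s => by positivity) (fun s hs => ?_) hA0 ?_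
    · exact measurable_const.mul (Measurable.ite measurableSet_Iio (by fun_prop) measurable_const)
    · by_cases h : s < p.1.1
      · simp only [h, if_true]
        have e : (fun z => Real.exp (r * s) * duhamelFun k p (s, z))
            = Real.exp (r * s) • fun z => duhamelFun k p (s, z) := rfl
        rw [e, eLpNorm_const_smul, mul_comm C, ENNReal.ofReal_mul (by positivity)]
        gcongr
        · rw [Real.enorm_eq_ofReal (by positivity)]
        · exact (hk.eLpNorm_slice_le p hs).trans (ENNReal.ofReal_le_ofReal
            ((W.norm_coe_le_norm _).trans hC))
      · have e : (fun z => Real.exp (r * s) * duhamelFun k p (s, z)) = fun _ => 0 := by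
          ext z
          rw [hk.duhamelFun_eq_zero (p := p.1) (q := (s, z)) (not_lt.1 h), mul_zero]
        simp only [e]
        simp
    · simp only [mul_pow]
      simp_rw [ENNReal.ofReal_mul (sq_nonneg C)]
      rw [lintegral_const_mul' _ _ ENNReal.ofReal_ne_top]
      refine (mul_le_mul_right (lintegral_exp_le hr) _).trans ?_
      rw [← ENNReal.ofReal_mul (sq_nonneg C)]
      refine ENNReal.ofReal_le_ofReal (le_of_eq ?_)
      rw [hA, mul_pow, div_pow, Real.sq_sqrt (by positivity), ← Real.exp_nat_mul]
      push_cast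
      rw [show 2 * (r * p.1.1) = 2 * r * p.1.1 by ring]
      ring
  have hmem : MemLp (fun q : ℝ × ℝ => Real.exp (r * q.1) * duhamelFun k p q) 2
      ((volume : Measure (ℝ × ℝ)).restrict (OT T)) :=
    ⟨hmeas.aestronglyMeasurable, hnorm.trans_lt ENNReal.ofReal_lt_top⟩
  have hn : ‖hmem.toLp _‖ ≤ A := by
    rw [Lp.norm_toLp]
    exact ENNReal.toReal_le_of_le_ofReal hA0 hnorm
  -- The hypothesis compares absolute values, so Cauchy–Schwarz is applied to the absolute values as
  -- elements of `L²`.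
  have habs : ∀ u : L2OT T, ∃ v : L2OT T, ‖v‖ = ‖u‖ ∧
      ∀ᵐ q ∂(volume : Measure (ℝ × ℝ)).restrict (OT T), v q = |u q| := fun u =>
    ⟨|u|, norm_abs_eq_norm u, Lp.coeFn_abs u⟩
  obtain ⟨P, hPn, hP⟩ := habs (hmem.toLp _)
  obtain ⟨Q, hQn, hQ⟩ := habs H
  calc |inner ℝ (hk.ker hT p) F| ≤ inner ℝ P Q := by
        rw [inner_eq_integral, inner_eq_integral, ← Real.norm_eq_abs]
        refine norm_integral_le_of_norm_le ?_ ?_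
        · have := L2.integrable_inner (𝕜 := ℝ) P Q
          refine this.congr (Eventually.of_forall fun q => by simp [mul_comm])
        · filter_upwards [hP, hQ, hFH, hk.coeFn_ker hT p, hmem.coeFn_toLp] with q h1 h2 h3 h4 h5
          rw [h1, h2, h4, h5, norm_mul, abs_mul, Real.abs_exp]
          calc ‖duhamelFun k p q‖ * ‖F q‖
              ≤ |duhamelFun k p q| * (Real.exp (r * q.1) * |H q|) :=
                mul_le_mul_of_nonneg_left h3 (norm_nonneg _)
            _ = _ := by ring
    _ ≤ ‖P‖ * ‖Q‖ := real_inner_le_norm _ _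
    _ ≤ A * ‖H‖ := by rw [hPn, hQn]; gcongr

/-- Iterated Duhamel integrals are integrals over the space-time domain. -/
lemma integral_duhamel (hT : 0 ≤ T) (hk : Represents k W) (p : OT T) {F : ℝ × ℝ → ℝ}
    (hF : MemLp F 2 ((volume : Measure (ℝ × ℝ)).restrict (OT T))) :
    ∫ s in (0 : ℝ)..p.1.1, ∫ z in (0 : ℝ)..1, k (p.1.1 - s) p.1.2 z * F (s, z)
      = ∫ q in OT T, duhamelFun k p q * F q := by
  have hp := p.2
  simp only [OT, mem_prod, mem_Icc] at hp
  have hint : Integrable (fun q => duhamelFun k p q * F q)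
      ((volume : Measure (ℝ × ℝ)).restrict (OT T)) :=
    (hk.memLp_duhamelFun hT p).integrable_mul hF
  have h1 : ∫ q in OT T, duhamelFun k p q * F q
      = ∫ s in Icc 0 T, ∫ z in Icc (0 : ℝ) 1, duhamelFun k p (s, z) * F (s, z) := by
    rw [restrict_OT] at hint ⊢
    exact integral_prod _ hint
  rw [h1, setIntegral_eq_of_subset_of_forall_sdiff_eq_zero measurableSet_Icc
    (Icc_subset_Icc_right hp.1.2 : Icc 0 p.1.1 ⊆ Icc 0 T)]
  · rw [intervalIntegral.integral_of_le hp.1.1, ← integral_Icc_eq_integral_Ioc]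
    refine setIntegral_congr_fun measurableSet_Icc fun s hs => ?_
    rw [intervalIntegral.integral_of_le zero_le_one, ← integral_Icc_eq_integral_Ioc]
    simp only [duhamelFun]
    rw [max_eq_left (by linarith [hs.2])]
  · intro s hs
    have h2 : p.1.1 ≤ s := by
      by_contra h
      exact hs.2 ⟨hs.1.1, (not_le.1 h).le⟩
    simp [hk.duhamelFun_eq_zero (p := p.1) (q := (s, _)) h2]

end Represents

end Duhamel

/-! ### Identification of the integral equations with the abstract equation -/

section Bridge

variable {T : ℝ} {b σ : ℝ → ℝ} {L : ℝ} {k : ℝ → ℝ → ℝ → ℝ} {W : C(OT T, L2I)}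

/-- The skeleton equation in integral form is an abstract skeleton equation. -/
lemma integral_equation_iff (hc : LipCoef b σ L) (hT : 0 ≤ T) (hk : Represents k W)
    (D : SkeletonData T) (hD : D.ker = hk.ker hT) {I : ℝ → ℝ → ℝ}
    (hI : ∀ p : OT T, D.init p = I p.1.1 p.1.2) (h : L2OT T) (f : C(OT T, ℝ)) :
    (∀ t ∈ Icc (0 : ℝ) T, ∀ x ∈ Icc (0 : ℝ) 1, ev f t x = I t x
      + (∫ s in (0 : ℝ)..t, ∫ z in (0 : ℝ)..1, k (t - s) x z * b (ev f s (D.node z)))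
      + (∫ s in (0 : ℝ)..t, ∫ z in (0 : ℝ)..1,
          k (t - s) x z * σ (ev f s (D.node z)) * h (s, z))) ↔ D.rhs hc h f = f := by
  have key : ∀ p : OT T, D.rhs hc h f p = I p.1.1 p.1.2
      + (∫ s in (0 : ℝ)..p.1.1, ∫ z in (0 : ℝ)..1,
          k (p.1.1 - s) p.1.2 z * b (ev f s (D.node z)))
      + (∫ s in (0 : ℝ)..p.1.1, ∫ z in (0 : ℝ)..1,
          k (p.1.1 - s) p.1.2 z * σ (ev f s (D.node z)) * h (s, z)) := by
    intro p
    have hb := memLp_comp_nodeEv D.measurable_node hc.continuous_left f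
    have hs := memLp_comp_nodeEv_mul D.measurable_node hc.continuous_right f (Lp.memLp h)
    have e1 := hk.integral_duhamel hT p hb
    have e2 := hk.integral_duhamel hT p hs
    simp only [nodeEv, ← mul_assoc] at e1 e2
    rw [e1, e2, SkeletonData.rhs, ContinuousMap.add_apply, hI, pair_apply, hD, add_assoc]
    congr 1
    rw [inner_eq_integral, ← integral_add]
    · refine integral_congr_ae ?_
      filter_upwards [hk.coeFn_ker hT p, coeFn_forcing hc D.measurable_node h f] with q h1 h2
      rw [h1, h2]
      simp only [forcingFun, nodeEv]; ring
    · exact (hk.memLp_duhamelFun hT p).integrable_mul hb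
    · refine ((hk.memLp_duhamelFun hT p).integrable_mul hs).congr
        (Eventually.of_forall fun q => ?_)
      simp only [Pi.mul_apply, nodeEv]; ring
  constructor
  · intro H
    ext p
    have hp := p.2
    rw [key, ← H _ hp.1 _ hp.2, ev_coe]
  · intro H t ht x hx
    have h1 := key ⟨(t, x), ht, hx⟩
    rw [H, ← ev_coe] at h1
    exact h1

end Bridge

/-! ### Nodes and interpolation -/

section Nodes

lemma measurable_comp_kappa (n : ℕ) (w : ℝ → ℝ) : Measurable fun z => w (kappa n z) := by
  have h1 : Measurable fun m : ℤ => w ((m : ℝ) / n) := measurable_from_top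
  exact h1.comp (Int.measurable_floor.comp (measurable_id.mul_const (n : ℝ)))

lemma measurable_kappa (n : ℕ) : Measurable (kappa n) := measurable_comp_kappa n id

lemma kappa_mem_Icc {n : ℕ} {z : ℝ} (hz : z ∈ Icc (0 : ℝ) 1) :
    kappa n z ∈ Icc (0 : ℝ) 1 := by
  rcases Nat.eq_zero_or_pos n with rfl | hn
  · simp [kappa]
  have hn' : (0 : ℝ) < n := by exact_mod_cast hn
  have h1 : (0 : ℝ) ≤ z * n := mul_nonneg hz.1 hn'.le
  refine ⟨div_nonneg (by exact_mod_cast Int.floor_nonneg.2 h1) hn'.le, ?_⟩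
  rw [kappa, div_le_one hn']
  exact (Int.floor_le _).trans (by nlinarith [hz.2])

lemma kappa_le {n : ℕ} (hn : 0 < n) (z : ℝ) : kappa n z ≤ z := by
  have hn' : (0 : ℝ) < n := by exact_mod_cast hn
  rw [kappa, div_le_iff₀ hn']
  exact Int.floor_le _

lemma lt_kappa_add {n : ℕ} (hn : 0 < n) (z : ℝ) : z < kappa n z + 1 / n := by
  have hn' : (0 : ℝ) < n := by exact_mod_cast hn
  rw [kappa, ← add_div, lt_div_iff₀ hn']
  exact Int.lt_floor_add_one _

lemma abs_kappa_sub_le {n : ℕ} (hn : 0 < n) (z : ℝ) : |kappa n z - z| ≤ 1 / n := by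
  rw [abs_le]
  constructor <;> linarith [kappa_le hn z, lt_kappa_add hn z,
    (by positivity : (0 : ℝ) ≤ 1 / n)]

lemma interp_eq {n : ℕ} (w : ℝ → ℝ) (x : ℝ) :
    interp n w x = (1 - Int.fract (n * x)) * w (kappa n x)
      + Int.fract (n * x) * w (kappa n x + 1 / n) := by
  rw [interp, Int.self_sub_floor]; ring

lemma abs_interp_le {n : ℕ} {w : ℝ → ℝ} {B : ℝ} (hw : ∀ x, |w x| ≤ B) (x : ℝ) :
    |interp n w x| ≤ B := by
  have h0 := Int.fract_nonneg (n * x)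
  have h1 := (Int.fract_lt_one (n * x)).le
  rw [interp_eq]
  refine (abs_add_le _ _).trans ?_
  rw [abs_mul, abs_mul, abs_of_nonneg h0, abs_of_nonneg (sub_nonneg.2 h1)]
  nlinarith [hw (kappa n x), hw (kappa n x + 1 / n)]

lemma abs_interp_sub_le {n : ℕ} (hn : 0 < n) {w : ℝ → ℝ} {K : ℝ} (hK : 0 ≤ K)
    (hw : ∀ x y, |w x - w y| ≤ K * |x - y|) (x : ℝ) : |interp n w x - w x| ≤ K * (1 / n) := by
  have h0 := Int.fract_nonneg (n * x)
  have h1 := (Int.fract_lt_one (n * x)).le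
  have e : interp n w x - w x = (1 - Int.fract (n * x)) * (w (kappa n x) - w x)
      + Int.fract (n * x) * (w (kappa n x + 1 / n) - w x) := by
    rw [interp_eq]; ring
  have h2 : |w (kappa n x) - w x| ≤ K * (1 / n) :=
    (hw _ _).trans (mul_le_mul_of_nonneg_left (abs_kappa_sub_le hn x) hK)
  have h3 : |w (kappa n x + 1 / n) - w x| ≤ K * (1 / n) := by
    refine (hw _ _).trans (mul_le_mul_of_nonneg_left ?_ hK)
    rw [abs_le]
    constructor <;> linarith [kappa_le hn x, lt_kappa_add hn x,
      (by positivity : (0 : ℝ) ≤ 1 / n)]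
  rw [e]
  refine (abs_add_le _ _).trans ?_
  rw [abs_mul, abs_mul, abs_of_nonneg h0, abs_of_nonneg (sub_nonneg.2 h1)]
  nlinarith

/-- The function is affine on every closed cell `[m, m + 1]`. A non-integer point is interior to its
cell, and at an integer the two adjacent cells are glued. -/
lemma continuous_floor_interp (V : ℤ → ℝ) :
    Continuous fun y : ℝ => V ⌊y⌋ + (y - (⌊y⌋ : ℝ)) * (V (⌊y⌋ + 1) - V ⌊y⌋) := by
  set g := fun y : ℝ => V ⌊y⌋ + (y - (⌊y⌋ : ℝ)) * (V (⌊y⌋ + 1) - V ⌊y⌋) with hg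
  have hcell : ∀ m : ℤ, ContinuousOn g (Icc (m : ℝ) (m + 1)) := by
    intro m
    have : ContinuousOn (fun y : ℝ => V m + (y - m) * (V (m + 1) - V m)) (Icc (m : ℝ) (m + 1)) := by
      fun_prop
    refine this.congr fun y hy => ?_
    -- At the right endpoint the floor jumps to `m + 1`, but both formulas give `V (m + 1)` there.
    rcases hy.2.eq_or_lt with h | h
    · have hf : ⌊y⌋ = m + 1 := by rw [h]; exact_mod_cast Int.floor_intCast (m + 1)
      simp only [hg, hf]
      rw [h]
      push_cast
      ring
    · have hf : ⌊y⌋ = m := Int.floor_eq_iff.2 ⟨hy.1, h⟩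
      simp only [hg, hf]
  refine continuous_iff_continuousAt.2 fun y => ?_
  have h1 : ContinuousWithinAt g (Icc (⌊y⌋ : ℝ) (⌊y⌋ + 1)) y :=
    hcell ⌊y⌋ y ⟨Int.floor_le y, (Int.lt_floor_add_one y).le⟩
  rcases (Int.floor_le y).eq_or_lt with h | h
  · have h2 := hcell (⌊y⌋ - 1) y
      ⟨by push_cast; linarith, by push_cast; linarith⟩
    refine (h2.union h1).continuousAt ?_
    push_cast
    rw [sub_add_cancel, Icc_union_Icc_eq_Icc (by linarith) (by linarith)]
    exact Icc_mem_nhds (by linarith) (by linarith)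
  · exact h1.continuousAt (Icc_mem_nhds h (Int.lt_floor_add_one y))

lemma continuous_interp {n : ℕ} (w : ℝ → ℝ) : Continuous (interp n w) := by
  have h := (continuous_floor_interp fun m : ℤ => w ((m : ℝ) / n)).comp
    (by fun_prop : Continuous fun x : ℝ => (n : ℝ) * x)
  convert h using 1
  ext x
  simp only [interp, kappa, Function.comp]
  push_cast
  rw [mul_comm x, add_div]

/-- No regularity of `F` is needed: `F ∘ κ_n` is constant on each open cell, and the endpoints form
a null set. -/
lemma integral_comp_kappa {n : ℕ} (hn : 0 < n) (F : ℝ → ℝ) :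
    ∫ z in Icc (0 : ℝ) 1, F (kappa n z) = 1 / n * ∑ i ∈ Finset.range n, F (i / n) := by
  have hn' : (0 : ℝ) < n := by exact_mod_cast hn
  have hcell : ∀ i : ℕ, ∀ z ∈ Ioo ((i : ℝ) / n) ((i + 1 : ℕ) / n), F (kappa n z) = F (i / n) := by
    intro i z hz
    have : ⌊z * n⌋ = (i : ℤ) := by
      rw [Int.floor_eq_iff]
      have h1 := (div_lt_iff₀ hn').1 hz.1
      have h2 := (lt_div_iff₀ hn').1 hz.2
      push_cast at h2 ⊢
      exact ⟨h1.le, h2⟩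
    rw [kappa, this]; simp
  have hle : ∀ i : ℕ, (i : ℝ) / n ≤ (i + 1 : ℕ) / n := fun i => by gcongr; simp
  have hint : ∀ i : ℕ, IntervalIntegrable (fun z => F (kappa n z)) volume (i / n)
      ((i + 1 : ℕ) / n) := by
    intro i
    have h0 : IntervalIntegrable (fun _ : ℝ => F (i / n)) volume (i / n) ((i + 1 : ℕ) / n) :=
      intervalIntegrable_const
    rw [intervalIntegrable_iff_integrableOn_Ioo_of_le (hle i)] at h0 ⊢
    exact h0.congr_fun (fun z hz => (hcell i z hz).symm) measurableSet_Ioo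
  have h1 := intervalIntegral.sum_integral_adjacent_intervals (a := fun i : ℕ => (i : ℝ) / n)
    (n := n) (f := fun z => F (kappa n z)) (μ := volume) fun i _ => hint i
  simp only [Nat.cast_zero, zero_div, div_self hn'.ne'] at h1
  rw [integral_Icc_eq_integral_Ioc, ← intervalIntegral.integral_of_le zero_le_one, ← h1,
    Finset.mul_sum]
  refine Finset.sum_congr rfl fun i _ => ?_
  rw [intervalIntegral.integral_of_le (hle i), integral_Ioc_eq_integral_Ioo,
    setIntegral_congr_fun measurableSet_Ioo (hcell i), setIntegral_const]
  simp only [Measure.real, Real.volume_Ioo, smul_eq_mul]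
  rw [ENNReal.toReal_ofReal (sub_nonneg.2 (hle i))]
  push_cast
  field_simp
  ring

end Nodes

/-! ### Trigonometric sums -/

section Trig

open Real

lemma abs_phi_le (j : ℕ) (x : ℝ) : |phi j x| ≤ √2 := by
  rw [phi, abs_mul, abs_of_nonneg (sqrt_nonneg 2)]
  exact mul_le_of_le_one_right (sqrt_nonneg 2) (abs_sin_le_one _)

lemma continuous_phi (j : ℕ) : Continuous (phi j) := by unfold phi; fun_prop

lemma abs_phi_sub_le (j : ℕ) (x y : ℝ) : |phi j x - phi j y| ≤ √2 * (j * π) * |x - y| := by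
  rw [phi, phi, ← mul_sub, abs_mul, abs_of_nonneg (sqrt_nonneg 2), mul_assoc (√2)]
  refine mul_le_mul_of_nonneg_left ?_ (sqrt_nonneg 2)
  calc _ ≤ |j * π * x - j * π * y| := abs_sin_sub_sin_le _ _
    _ = _ := by rw [← mul_sub, abs_mul, abs_of_nonneg (by positivity)]

lemma phi_zero (x : ℝ) : phi 0 x = 0 := by simp [phi]

lemma phi_mul_phi (i j : ℕ) (x : ℝ) :
    phi i x * phi j x = cos (((i : ℤ) - j : ℤ) * π * x) - cos (((i : ℤ) + j : ℤ) * π * x) := by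
  have h : √2 * √2 = 2 := mul_self_sqrt (by norm_num)
  have e : phi i x * phi j x = √2 * √2 * (sin (i * π * x) * sin (j * π * x)) := by
    unfold phi; ring
  rw [e, h]
  push_cast
  rw [show ((i : ℝ) - j) * π * x = i * π * x - j * π * x by ring,
    show ((i : ℝ) + j) * π * x = i * π * x + j * π * x by ring, cos_sub, cos_add]
  ring

lemma integral_cos_int (m : ℤ) :
    ∫ z in (0 : ℝ)..1, cos (m * π * z) = if m = 0 then 1 else 0 := by
  split_ifs with h
  · simp [h]
  · have hm : (m : ℝ) * π ≠ 0 := mul_ne_zero (by exact_mod_cast h) pi_ne_zero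
    rw [intervalIntegral.integral_comp_mul_left (fun z => cos z) hm, integral_cos]
    simp [sin_int_mul_pi]

lemma integral_phi_mul_phi {i j : ℕ} (hi : 1 ≤ i) :
    ∫ z in Icc (0 : ℝ) 1, phi i z * phi j z = if i = j then 1 else 0 := by
  rw [integral_Icc_eq_integral_Ioc, ← intervalIntegral.integral_of_le zero_le_one]
  simp_rw [phi_mul_phi]
  rw [intervalIntegral.integral_sub (by apply Continuous.intervalIntegrable; fun_prop)
    (by apply Continuous.intervalIntegrable; fun_prop), integral_cos_int, integral_cos_int,
    if_neg (by omega : ¬((i : ℤ) + j = 0)), sub_zero]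
  congr 1
  rw [eq_iff_iff]; omega

lemma two_sin_mul_sum_cos (θ : ℝ) (n : ℕ) :
    2 * sin (θ / 2) * ∑ i ∈ Finset.range n, cos (i * θ)
      = sin (n * θ - θ / 2) + sin (θ / 2) := by
  induction n with
  | zero => simp [sin_neg]
  | succ n ih =>
    rw [Finset.sum_range_succ, mul_add, ih]
    push_cast
    rw [show ((n : ℝ) + 1) * θ - θ / 2 = n * θ + θ / 2 by ring, sin_add, sin_sub]
    ring

/-- The sum `∑_{i < n} cos (i m π / n)` only depends on the parity of `m`, for `0 < |m| < 2 n`. -/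
lemma sum_cos_int {n : ℕ} {m : ℤ} (hm0 : m ≠ 0) (hm : |m| < 2 * n) :
    2 * ∑ i ∈ Finset.range n, cos (m * π * (i / n)) = 1 - cos (m * π) := by
  have hn : (0 : ℝ) < n := by
    have : (0 : ℤ) < n := by have := abs_nonneg m; omega
    exact_mod_cast this
  have h1 := two_sin_mul_sum_cos (m * π / n) n
  have e1 : (n : ℝ) * (m * π / n) = m * π := by field_simp
  rw [e1, sin_sub, sin_int_mul_pi, zero_mul, zero_sub] at h1
  -- The angle is nonzero and lies strictly between `-π` and `π`, because `0 < |m| < 2 n`.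
  have hs : sin (m * π / n / 2) ≠ 0 := by
    have hmr : |(m : ℝ)| < 2 * n := by exact_mod_cast hm
    have hm0' : (m : ℝ) ≠ 0 := by exact_mod_cast hm0
    rw [abs_lt] at hmr
    have hlt : m * π / n / 2 < π := by
      rw [div_div, div_lt_iff₀ (by positivity)]
      nlinarith [pi_pos]
    have hgt : -π < m * π / n / 2 := by
      rw [div_div, lt_div_iff₀ (by positivity)]
      nlinarith [pi_pos]
    rw [Ne, sin_eq_zero_iff_of_lt_of_lt hgt hlt]
    have := pi_pos
    positivity
  have h2 : sin (m * π / n / 2) * (2 * ∑ i ∈ Finset.range n, cos (i * (m * π / n)))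
      = sin (m * π / n / 2) * (1 - cos (m * π)) := by linarith
  have h3 := mul_left_cancel₀ hs h2
  rw [← h3]
  congr 1
  exact Finset.sum_congr rfl fun i _ => by congr 1; ring

/-- The frequencies `i - j` and `i + j` have the same parity, so for `i ≠ j` their cosine sums agree
and cancel. For `i = j` the sum at frequency `2 i` vanishes and the one at frequency `0` gives `n`.
-/
lemma sum_phi_mul_phi {n i j : ℕ} (hi : 1 ≤ i) (hin : i < n) (hjn : j < n) :
    1 / (n : ℝ) * ∑ l ∈ Finset.range n, phi i (l / n) * phi j (l / n) = if i = j then 1 else 0 := by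
  have hn : (n : ℝ) ≠ 0 := by have : n ≠ 0 := by omega
                              exact_mod_cast this
  have hsum := sum_cos_int (n := n) (m := (i : ℤ) + j) (by omega) (by rw [abs_lt]; omega)
  simp_rw [phi_mul_phi]
  rw [Finset.sum_sub_distrib]
  split_ifs with h
  · subst h
    have hc : cos (((i : ℤ) + (i : ℤ) : ℤ) * π) = 1 := by
      have := cos_int_mul_two_pi (i : ℤ)
      push_cast at this ⊢
      rw [← this]; congr 1; ring
    rw [hc] at hsum
    have h0 : ∑ l ∈ Finset.range n, cos (((i : ℤ) + (i : ℤ) : ℤ) * π * (l / n)) = 0 := by linarith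
    rw [h0]
    simp [hn]
  · have hdiff := sum_cos_int (n := n) (m := (i : ℤ) - j) (by omega) (by rw [abs_lt]; omega)
    have hc : cos (((i : ℤ) + (j : ℤ) : ℤ) * π) = cos (((i : ℤ) - (j : ℤ) : ℤ) * π) := by
      push_cast
      rw [add_mul, sub_mul, cos_add, cos_sub]
      have : sin ((j : ℝ) * π) = 0 := sin_nat_mul_pi j
      rw [this]; ring
    rw [hc] at hsum
    have : ∑ l ∈ Finset.range n, cos (((i : ℤ) - (j : ℤ) : ℤ) * π * (l / n))
        - ∑ l ∈ Finset.range n, cos (((i : ℤ) + (j : ℤ) : ℤ) * π * (l / n)) = 0 := by linarith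
    rw [this, mul_zero]

lemma two_sin_mul_sum_sin (θ : ℝ) (n : ℕ) :
    2 * sin (θ / 2) * ∑ i ∈ Finset.range n, sin ((i + 1 : ℕ) * θ)
      = cos (θ / 2) - cos (n * θ + θ / 2) := by
  induction n with
  | zero => simp
  | succ n ih =>
    rw [Finset.sum_range_succ, mul_add, ih]
    push_cast
    rw [show (n : ℝ) * θ + θ / 2 = (n + 1) * θ - θ / 2 by ring, cos_sub, cos_add]
    ring

/-- Dirichlet's test: the sine sums are bounded by `1 / |sin (θ / 2)|`. If that sine is zero, every
term vanishes. -/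
lemma cauchySeq_sum_sin_div (θ : ℝ) :
    CauchySeq fun N : ℕ => ∑ j ∈ Finset.range N, (1 / ((j : ℝ) + 1)) * sin ((j + 1 : ℕ) * θ) := by
  by_cases h : sin (θ / 2) = 0
  · obtain ⟨m, hm⟩ := sin_eq_zero_iff.1 h
    have h0 : ∀ j : ℕ, sin ((j + 1 : ℕ) * θ) = 0 := by
      intro j
      have e : ((j + 1 : ℕ) : ℝ) * θ = ((2 * (j + 1 : ℕ) * m : ℤ) : ℝ) * π := by
        push_cast
        rw [show θ = 2 * (m * π) by linarith]; ring
      rw [e, sin_int_mul_pi]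
    simp only [h0, mul_zero, Finset.sum_const_zero]
    exact cauchySeq_const 0
  · refine Antitone.cauchySeq_series_mul_of_tendsto_zero_of_bounded
      (f := fun j : ℕ => 1 / ((j : ℝ) + 1)) (z := fun j : ℕ => sin ((j + 1 : ℕ) * θ))
      (b := 1 / |sin (θ / 2)|) ?_ tendsto_one_div_add_atTop_nhds_zero_nat ?_
    · intro a b hab
      have : (a : ℝ) ≤ b := by exact_mod_cast hab
      exact one_div_le_one_div_of_le (by positivity) (by linarith)
    · intro n
      have h1 := two_sin_mul_sum_sin θ n
      have hpos : 0 < |sin (θ / 2)| := abs_pos.2 h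
      rw [norm_eq_abs, le_div_iff₀ hpos]
      have h2 : |2 * sin (θ / 2) * ∑ i ∈ Finset.range n, sin ((i + 1 : ℕ) * θ)| ≤ 2 := by
        rw [h1]
        refine (abs_sub _ _).trans ?_
        linarith [abs_cos_le_one (θ / 2), abs_cos_le_one (n * θ + θ / 2)]
      rw [abs_mul, abs_mul, abs_of_pos (by norm_num : (0 : ℝ) < 2)] at h2
      linarith

/-- A product of three sines is a combination of four sines with angles proportional to `±t ± x ±
z`, which reduces the claim to four series `∑ sin (j θ) / j`. -/
lemma tendsto_green (t x z : ℝ) :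
    Tendsto (fun N : ℕ => ∑ j ∈ Finset.Icc 1 N,
      sin (j * π * t) / (j * π) * phi j x * phi j z) atTop (𝓝 (green t x z)) := by
  refine CauchySeq.tendsto_limUnder ?_
  have h := (((cauchySeq_sum_sin_div (π * (t + x - z))).add
    (cauchySeq_sum_sin_div (π * (t - x + z)))).add
    (cauchySeq_sum_sin_div (π * (-t + x + z)))).add
    (cauchySeq_sum_sin_div (π * (t + x + z))).neg
  obtain ⟨l, hl⟩ := cauchySeq_tendsto_of_complete h
  refine Tendsto.cauchySeq (x := 1 / (2 * π) * l) ?_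
  refine (hl.const_mul (1 / (2 * π))).congr fun N => ?_
  simp only [Pi.add_apply, Pi.neg_apply]
  rw [← Finset.sum_neg_distrib, ← Finset.sum_add_distrib, ← Finset.sum_add_distrib,
    ← Finset.sum_add_distrib, Finset.mul_sum, ← Finset.Ico_succ_right_eq_Icc, Order.succ_eq_add_one,
    Finset.sum_Ico_eq_sum_range]
  refine Finset.sum_congr (by simp) fun j _ => ?_
  have hsq : √2 * √2 = 2 := mul_self_sqrt (by norm_num)
  have hj : (j : ℝ) + 1 ≠ 0 := by positivity
  have e : ∀ T A B : ℝ, sin (T + A - B) + sin (T - A + B) + sin (-T + A + B) - sin (T + A + B)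
      = 4 * (sin T * sin A * sin B) := by
    intro T A B
    simp only [sin_add, sin_sub, cos_add, cos_sub, sin_neg, cos_neg]
    ring
  have e' := e ((j + 1) * π * t) ((j + 1) * π * x) ((j + 1) * π * z)
  unfold phi
  push_cast
  have r1 : ((j : ℝ) + 1) * (π * (t + x - z)) = (j + 1) * π * t + (j + 1) * π * x
      - (j + 1) * π * z := by ring
  have r2 : ((j : ℝ) + 1) * (π * (t - x + z)) = (j + 1) * π * t - (j + 1) * π * x
      + (j + 1) * π * z := by ring
  have r3 : ((j : ℝ) + 1) * (π * (-t + x + z)) = -((j + 1) * π * t) + (j + 1) * π * x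
      + (j + 1) * π * z := by ring
  have r4 : ((j : ℝ) + 1) * (π * (t + x + z)) = (j + 1) * π * t + (j + 1) * π * x
      + (j + 1) * π * z := by ring
  rw [r1, r2, r3, r4, add_comm (1 : ℝ) (j : ℝ)]
  calc _ = 1 / (2 * π) * (1 / ((j : ℝ) + 1)) * (4 * (sin ((j + 1) * π * t)
        * sin ((j + 1) * π * x) * sin ((j + 1) * π * z))) := by rw [← e']; ring
    _ = sin ((j + 1) * π * t) / ((j + 1) * π) * (√2 * √2)
        * (sin ((j + 1) * π * x) * sin ((j + 1) * π * z)) := by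
      rw [hsq]; field_simp; ring
    _ = _ := by ring

/-- The square root of `c_j^n` as a frequency correction. -/
def freq (n j : ℕ) : ℝ := √(cCoef n j)

lemma freq_eq {n j : ℕ} (hn : 0 < n) (hj : 0 < j) : freq n j = |sinc (j / (2 * n) * π)| := by
  have h : (j : ℝ) / (2 * n) * π ≠ 0 := by positivity
  rw [freq, cCoef, ← div_pow, sqrt_sq_eq_abs, sinc_of_ne_zero h]

/-- Jordan's inequality `sin y ≥ 2 y / π` at `y = j π / (2 n) ≤ π / 2`. -/
lemma div_le_sin {n j : ℕ} (hj : j < n) : (j : ℝ) / n ≤ sin (j / (2 * n) * π) := by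
  have hn : (0 : ℝ) < n := by exact_mod_cast (by omega : 0 < n)
  have hj' : (j : ℝ) ≤ n := by exact_mod_cast hj.le
  have h1 := mul_le_sin (x := (j : ℝ) / (2 * n) * π) (by positivity) (by
    rw [div_mul_eq_mul_div, div_le_div_iff₀ (by positivity) (by positivity)]
    nlinarith [pi_pos])
  refine le_trans (le_of_eq ?_) h1
  field_simp

/-- Keeps the discrete frequencies comparable to the continuous ones for all `j < n`, so that the
coefficients of both Green functions obey the same bound `1 / j`. -/
lemma two_div_pi_le_freq {n j : ℕ} (hj0 : 0 < j) (hj : j < n) : 2 / π ≤ freq n j := by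
  have hn : 0 < n := by omega
  rw [freq_eq hn hj0, sinc_of_ne_zero (by positivity)]
  refine le_trans ?_ (le_abs_self _)
  rw [le_div_iff₀ (by positivity)]
  refine le_trans (le_of_eq ?_) (div_le_sin hj)
  field_simp

lemma freq_pos {n j : ℕ} (hj0 : 0 < j) (hj : j < n) : 0 < freq n j :=
  lt_of_lt_of_le (by positivity) (two_div_pi_le_freq hj0 hj)

lemma tendsto_freq {j : ℕ} (hj : 0 < j) : Tendsto (fun n => freq n j) atTop (𝓝 1) := by
  have h1 : Tendsto (fun n : ℕ => (j : ℝ) / (2 * n) * π) atTop (𝓝 0) := by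
    have := (tendsto_const_div_atTop_nhds_zero_nat ((j : ℝ) / 2)).mul_const π
    rw [zero_mul] at this
    refine this.congr fun n => ?_
    rw [div_div]
  have h2 := ((continuous_sinc.tendsto 0).comp h1).abs
  rw [sinc_zero, abs_one] at h2
  refine h2.congr' ?_
  filter_upwards [eventually_gt_atTop 0] with n hn
  rw [freq_eq hn hj]; rfl

end Trig

/-! ### Decay of the sine coefficients of smooth functions -/

section Coefficients

open Real

/-- Second differences of a `C²` function on `[0,1]` are of second order. -/
lemma exists_second_difference_le {u : ℝ → ℝ} (hu : ContDiffOn ℝ 2 u (Icc 0 1)) :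
    ∃ M, 0 ≤ M ∧ ∀ x h, 0 ≤ x → 0 ≤ h → x + 2 * h ≤ 1 →
      |u (x + 2 * h) - 2 * u (x + h) + u x| ≤ M * h ^ 2 := by
  have hud : UniqueDiffOn ℝ (Icc (0 : ℝ) 1) := uniqueDiffOn_Icc zero_lt_one
  have hd : ContDiffOn ℝ 1 (derivWithin u (Icc 0 1)) (Icc 0 1) := hu.derivWithin hud (by norm_num)
  obtain ⟨K, hK⟩ := hd.exists_lipschitzOnWith one_ne_zero (convex_Icc 0 1) isCompact_Icc
  refine ⟨K, K.2, fun x h hx hh hxh => ?_⟩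
  have hdiff : ∀ y ∈ Icc (0 : ℝ) 1, HasDerivWithinAt u (derivWithin u (Icc 0 1) y) (Icc 0 1) y :=
    fun y hy => ((hu.differentiableOn (by norm_num)) y hy).hasDerivWithinAt
  -- The second difference is the increment over `[0, h]` of `s ↦ u (x + h + s) - u (x + s)`. The
  -- derivative of this function is at most `K h`, with `K` a Lipschitz constant of `u'`.
  have hF : ∀ s ∈ Icc 0 h, HasDerivWithinAt (fun s => u (x + h + s) - u (x + s))
      (derivWithin u (Icc 0 1) (x + h + s) - derivWithin u (Icc 0 1) (x + s)) (Icc 0 h) s := by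
    intro s hs
    have aux : ∀ c, 0 ≤ c → c + h ≤ 1 → HasDerivWithinAt (fun s => u (c + s))
        (derivWithin u (Icc 0 1) (c + s)) (Icc 0 h) s := by
      intro c hc hc1
      have h1 : HasDerivWithinAt (fun s : ℝ => c + s) 1 (Icc 0 h) s :=
        ((hasDerivAt_id s).const_add c).hasDerivWithinAt
      have h2 := (hdiff (c + s) ⟨by linarith [hs.1], by linarith [hs.2]⟩).comp s h1
        fun r hr => ⟨by linarith [hr.1], by linarith [hr.2]⟩
      rw [mul_one] at h2
      exact h2
    exact (aux (x + h) (by linarith) (by linarith)).sub (aux x hx (by linarith))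
  have h1 := Convex.norm_image_sub_le_of_norm_hasDerivWithin_le (C := K * h) hF (fun s hs => ?_)
    (convex_Icc 0 h) (left_mem_Icc.2 hh) (right_mem_Icc.2 hh)
  · rw [norm_eq_abs, norm_eq_abs, sub_zero, abs_of_nonneg hh] at h1
    have e : u (x + 2 * h) - 2 * u (x + h) + u x
        = u (x + h + h) - u (x + h) - (u (x + h + 0) - u (x + 0)) := by
      rw [add_zero, add_zero, show x + 2 * h = x + h + h by ring]; ring
    rw [e, pow_two, ← mul_assoc]
    exact h1
  · have h2 := hK.dist_le_mul (x + h + s) ⟨by linarith [hs.1], by linarith [hs.2]⟩ (x + s)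
      ⟨by linarith [hs.1], by linarith [hs.2]⟩
    rw [dist_eq_norm, dist_eq_norm] at h2
    refine h2.trans (le_of_eq ?_)
    rw [show x + h + s - (x + s) = h by ring, norm_of_nonneg hh]

/-- Summation by parts against an eigenvector of the discrete Laplacian. -/
lemma abs_mul_sum_le_of_recurrence {U P : ℕ → ℝ} {m : ℕ} {r B D : ℝ} (hB : 0 ≤ B)
    (hP2 : ∀ i, P (i + 2) + P i = (2 - r) * P (i + 1)) (hU0 : U 0 = 0) (hUn : U (m + 1) = 0)
    (hP0 : P 0 = 0) (hPn : P (m + 1) = 0) (hPB : ∀ i, |P i| ≤ B)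
    (hUD : ∀ i < m, |U (i + 2) - 2 * U (i + 1) + U i| ≤ D) :
    |r * ∑ i ∈ Finset.range (m + 1), P i * U i| ≤ m * (B * D) := by
  -- The discrete Wronskian `U i * P (i + 1) - P i * U (i + 1)` telescopes and vanishes at both
  -- ends.
  have htel : ∑ i ∈ Finset.range m, (U (i + 1) * (P (i + 2) + P i) - P (i + 1) * (U (i + 2) + U i))
      = 0 := by
    have h1 := Finset.sum_range_sub (fun i => U i * P (i + 1) - P i * U (i + 1)) m
    simp only [hU0, hP0, hUn, hPn, mul_zero, zero_mul, sub_zero] at h1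
    rw [← h1]
    exact Finset.sum_congr rfl fun i _ => by ring
  have hS : r * ∑ i ∈ Finset.range (m + 1), P i * U i
      = -∑ i ∈ Finset.range m, P (i + 1) * (U (i + 2) - 2 * U (i + 1) + U i) := by
    rw [Finset.sum_range_succ', hP0, zero_mul, add_zero, Finset.mul_sum,
      eq_neg_iff_add_eq_zero, ← Finset.sum_add_distrib, ← neg_eq_zero, ← Finset.sum_neg_distrib,
      ← htel]
    refine Finset.sum_congr rfl fun i _ => ?_
    rw [hP2]; ring
  rw [hS, abs_neg]
  refine (Finset.abs_sum_le_sum_abs _ _).trans ?_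
  refine (Finset.sum_le_card_nsmul _ _ (B * D) fun i hi => ?_).trans
    (by rw [Finset.card_range, nsmul_eq_mul])
  rw [abs_mul]
  exact mul_le_mul (hPB _) (hUD i (Finset.mem_range.1 hi)) (abs_nonneg _) hB

/-- Discrete sine coefficients of a function with small second differences decay quadratically. -/
lemma abs_discrete_coef_le {u : ℝ → ℝ} (hu0 : u 0 = 0) (hu1 : u 1 = 0) {M : ℝ} (hM0 : 0 ≤ M)
    (hM : ∀ x h, 0 ≤ x → 0 ≤ h → x + 2 * h ≤ 1 →
      |u (x + 2 * h) - 2 * u (x + h) + u x| ≤ M * h ^ 2) {n j : ℕ} (hj0 : 0 < j) (hj : j < n) :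
    |1 / (n : ℝ) * ∑ i ∈ Finset.range n, phi j (i / n) * u (i / n)| ≤ M / j ^ 2 := by
  obtain ⟨m, rfl⟩ : ∃ m, n = m + 1 := ⟨n - 1, by omega⟩
  obtain ⟨N, hN⟩ : ∃ N : ℝ, ((m + 1 : ℕ) : ℝ) = N := ⟨_, rfl⟩
  have hn : 0 < N := by rw [← hN]; positivity
  have hj' : (0 : ℝ) < j := by exact_mod_cast hj0
  have hsin := div_le_sin hj
  rw [hN] at hsin ⊢
  -- The sampled sine is an eigenvector of the second difference with eigenvalue `-4 sin² (j π / (2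
  -- n))`, and `div_le_sin` bounds the modulus from below by `4 (j / n)²`.
  have hmain := abs_mul_sum_le_of_recurrence (U := fun i => u (i / N)) (P := fun i => phi j (i / N))
    (m := m) (r := 4 * sin (j / (2 * N) * π) ^ 2) (B := √2) (D := M * (1 / N) ^ 2) (sqrt_nonneg 2)
    (fun i => ?_) (by simp [hu0]) (by rw [hN, div_self hn.ne', hu1]) (by simp [phi])
    (by rw [hN, div_self hn.ne']; simp [phi, sin_nat_mul_pi]) (fun i => abs_phi_le _ _)
    (fun i hi => ?_)
  · obtain ⟨S, hS⟩ : ∃ S, |∑ i ∈ Finset.range (m + 1), phi j (i / N) * u (i / N)| = S := ⟨_, rfl⟩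
    have hS0 : 0 ≤ S := hS ▸ abs_nonneg _
    rw [abs_mul, hS, abs_of_nonneg (by positivity)] at hmain
    rw [abs_mul, hS, abs_of_nonneg (by positivity), le_div_iff₀ (by positivity)]
    have hmn : (m : ℝ) ≤ N := by rw [← hN]; push_cast; linarith
    have hs2 : √2 ≤ 4 := by
      rw [sqrt_le_left (by norm_num)]; norm_num
    have hsq : ((j : ℝ) / N) ^ 2 ≤ sin (j / (2 * N) * π) ^ 2 :=
      pow_le_pow_left₀ (by positivity) hsin 2
    have h1 : 4 * ((j : ℝ) / N) ^ 2 * S ≤ N * (4 * (M * (1 / N) ^ 2)) := by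
      calc 4 * ((j : ℝ) / N) ^ 2 * S ≤ 4 * sin (j / (2 * N) * π) ^ 2 * S := by gcongr
        _ ≤ m * (√2 * (M * (1 / N) ^ 2)) := hmain
        _ ≤ N * (4 * (M * (1 / N) ^ 2)) := by gcongr
    have h4 : N * (4 * (M * (1 / N) ^ 2)) = 4 * (M / N) := by field_simp
    have h5 : 4 * ((j : ℝ) / N) ^ 2 * S = 4 * ((1 / N * S * j ^ 2) / N) := by field_simp
    rw [h4, h5] at h1
    have h6 := le_of_mul_le_mul_left h1 (by norm_num : (0 : ℝ) < 4)
    exact (div_le_div_iff_of_pos_right hn).1 h6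
  · simp only [phi]
    have e0 : (j : ℝ) * π * (i / N) = j * π * ((i + 1 : ℕ) / N) - 2 * (j / (2 * N) * π) := by
      push_cast; field_simp; ring
    have e2 : (j : ℝ) * π * ((i + 2 : ℕ) / N) = j * π * ((i + 1 : ℕ) / N)
        + 2 * (j / (2 * N) * π) := by
      push_cast; field_simp; ring
    rw [e0, e2, sin_add, sin_sub, cos_two_mul, cos_sq']
    ring
  · have hi' : (i : ℝ) + 2 ≤ N := by
      rw [← hN]
      exact_mod_cast (by omega : i + 2 ≤ m + 1)
    have h1 := hM (i / N) (1 / N) (by positivity) (by positivity) (by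
      rw [← mul_div_assoc, ← add_div, div_le_one hn]; linarith)
    have e1 : ((i + 1 : ℕ) : ℝ) / N = i / N + 1 / N := by push_cast; ring
    have e2 : ((i + 2 : ℕ) : ℝ) / N = i / N + 2 * (1 / N) := by push_cast; ring
    rw [e1, e2]
    exact h1

end Coefficients

/-! ### Functions on `[0,1]` as elements of `L²` -/

section Restriction

lemma memLp_restr {w : ℝ → ℝ} (hw : ContinuousOn w (Icc 0 1)) :
    MemLp w 2 ((volume : Measure ℝ).restrict (Icc (0 : ℝ) 1)) := by
  obtain ⟨B, hB⟩ := isCompact_Icc.exists_bound_of_continuousOn hw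
  refine MemLp.of_bound (hw.aestronglyMeasurable measurableSet_Icc) B ?_
  filter_upwards [ae_restrict_mem measurableSet_Icc] with z hz using hB z hz

lemma memLp_restrD (n : ℕ) {w : ℝ → ℝ} (hw : ContinuousOn w (Icc 0 1)) :
    MemLp (fun z => w (kappa n z)) 2 ((volume : Measure ℝ).restrict (Icc (0 : ℝ) 1)) := by
  obtain ⟨B, hB⟩ := isCompact_Icc.exists_bound_of_continuousOn hw
  refine MemLp.of_bound (measurable_comp_kappa n w).aestronglyMeasurable B ?_
  filter_upwards [ae_restrict_mem measurableSet_Icc] with z hz using hB _ (kappa_mem_Icc hz)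

/-- A continuous function on `[0,1]` as an element of `L²`. -/
def restr {w : ℝ → ℝ} (hw : ContinuousOn w (Icc 0 1)) : L2I := (memLp_restr hw).toLp _

/-- The step function `w ∘ κ_n` as an element of `L²`. -/
def restrD (n : ℕ) {w : ℝ → ℝ} (hw : ContinuousOn w (Icc 0 1)) : L2I := (memLp_restrD n hw).toLp _

lemma inner_toLp_eq {f g : ℝ → ℝ}
    (hf : MemLp f 2 ((volume : Measure ℝ).restrict (Icc (0 : ℝ) 1)))
    (hg : MemLp g 2 ((volume : Measure ℝ).restrict (Icc (0 : ℝ) 1))) :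
    inner ℝ (hf.toLp f) (hg.toLp g) = ∫ z in Icc (0 : ℝ) 1, f z * g z := by
  rw [L2.inner_def]
  refine integral_congr_ae ?_
  filter_upwards [hf.coeFn_toLp, hg.coeFn_toLp] with z h1 h2
  rw [h1, h2]; simp [mul_comm]

lemma abs_comp_kappa_sub_eventually_le {w : ℝ → ℝ} (hw : ContinuousOn w (Icc 0 1)) {ε : ℝ}
    (hε : 0 < ε) : ∀ᶠ n : ℕ in atTop, ∀ z ∈ Icc (0 : ℝ) 1, |w (kappa n z) - w z| ≤ ε := by
  obtain ⟨δ, hδ, h⟩ := Metric.uniformContinuousOn_iff.1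
    (isCompact_Icc.uniformContinuousOn_of_continuous hw) ε hε
  filter_upwards [eventually_gt_atTop 0, tendsto_one_div_atTop_nhds_zero_nat.eventually
    (gt_mem_nhds hδ)] with n hn hn' z hz
  exact (h _ (kappa_mem_Icc hz) z hz ((abs_kappa_sub_le hn z).trans_lt hn')).le

lemma norm_toLp_sub_toLp_le {f g : ℝ → ℝ}
    (hf : MemLp f 2 ((volume : Measure ℝ).restrict (Icc (0 : ℝ) 1)))
    (hg : MemLp g 2 ((volume : Measure ℝ).restrict (Icc (0 : ℝ) 1))) {ε : ℝ}
    (h : ∀ z ∈ Icc (0 : ℝ) 1, |f z - g z| ≤ ε) : ‖hf.toLp f - hg.toLp g‖ ≤ ε := by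
  have hε : 0 ≤ ε := (abs_nonneg _).trans (h 0 (by simp))
  rw [← MemLp.toLp_sub, Lp.norm_toLp]
  refine ENNReal.toReal_le_of_le_ofReal hε ?_
  refine (eLpNorm_le_of_ae_bound (C := ε) ?_).trans ?_
  · filter_upwards [ae_restrict_mem measurableSet_Icc] with z hz using h z hz
  · simp

lemma tendsto_restrD {w : ℝ → ℝ} (hw : ContinuousOn w (Icc 0 1)) :
    Tendsto (fun n => restrD n hw) atTop (𝓝 (restr hw)) := by
  rw [tendsto_iff_norm_sub_tendsto_zero, Metric.tendsto_nhds]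
  intro ε hε
  filter_upwards [abs_comp_kappa_sub_eventually_le hw (half_pos hε)] with n hn
  rw [Real.dist_0_eq_abs, abs_norm]
  exact (norm_toLp_sub_toLp_le _ _ hn).trans_lt (half_lt_self hε)

lemma inner_restrD {n : ℕ} (hn : 0 < n) {w w' : ℝ → ℝ} (hw : ContinuousOn w (Icc 0 1))
    (hw' : ContinuousOn w' (Icc 0 1)) :
    inner ℝ (restrD n hw) (restrD n hw')
      = 1 / n * ∑ i ∈ Finset.range n, w (i / n) * w' (i / n) := by
  rw [restrD, restrD, inner_toLp_eq]
  exact integral_comp_kappa hn fun z => w z * w' z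

lemma continuousOn_phi (j : ℕ) : ContinuousOn (phi j) (Icc 0 1) := (continuous_phi j).continuousOn

/-- The sine functions in `L²`. -/
def sineVec (j : ℕ) : L2I := restr (continuousOn_phi j)

/-- The discretized sine functions in `L²`. -/
def sineVecD (n j : ℕ) : L2I := restrD n (continuousOn_phi j)

lemma inner_sineVec {i j : ℕ} (hi : 1 ≤ i) :
    inner ℝ (sineVec i) (sineVec j) = if i = j then (1 : ℝ) else 0 := by
  rw [sineVec, sineVec, restr, restr, inner_toLp_eq, integral_phi_mul_phi hi]

lemma inner_sineVecD {n i j : ℕ} (hi : 1 ≤ i) (hin : i < n) (hjn : j < n) :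
    inner ℝ (sineVecD n i) (sineVecD n j) = if i = j then (1 : ℝ) else 0 := by
  rw [sineVecD, sineVecD, inner_restrD (by omega), sum_phi_mul_phi hi hin hjn]

lemma tendsto_sineVecD (j : ℕ) : Tendsto (fun n => sineVecD n j) atTop (𝓝 (sineVec j)) :=
  tendsto_restrD _

lemma coeFn_sum_smul_toLp {f : ℕ → ℝ → ℝ}
    (hf : ∀ j, MemLp (f j) 2 ((volume : Measure ℝ).restrict (Icc (0 : ℝ) 1)))
    (a : ℕ → ℝ) (s : Finset ℕ) :
    (∑ j ∈ s, a j • (hf j).toLp (f j) : L2I) =ᵐ[(volume : Measure ℝ).restrict (Icc (0 : ℝ) 1)]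
      fun z => ∑ j ∈ s, a j * f j z := by
  induction s using Finset.induction_on with
  | empty =>
    simp only [Finset.sum_empty]
    exact Lp.coeFn_zero ℝ 2 ((volume : Measure ℝ).restrict (Icc (0 : ℝ) 1))
  | insert i s hi ih =>
    rw [Finset.sum_insert hi]
    filter_upwards [Lp.coeFn_add (a i • (hf i).toLp (f i)) (∑ j ∈ s, a j • (hf j).toLp (f j)),
      Lp.coeFn_smul (a i) ((hf i).toLp (f i)), (hf i).coeFn_toLp, ih] with z h1 h2 h3 h4
    rw [h1, Pi.add_apply, h2, Pi.smul_apply, h3, h4, Finset.sum_insert hi, smul_eq_mul]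

end Restriction

/-! ### Orthogonal series and scalar multiples of fixed vectors -/

section Orthogonal

variable {E : Type*} [NormedAddCommGroup E]

lemma sum_Ico_eq_add {N M : ℕ} (h : N < M) (f : ℕ → E) :
    ∑ j ∈ Finset.Ico 1 M, f j = ∑ j ∈ Finset.Ico 1 (N + 1), f j + ∑ j ∈ Finset.Ico (N + 1) M, f j :=
  (Finset.sum_Ico_consecutive f (by omega) h).symm

variable [InnerProductSpace ℝ E]

lemma norm_sq_sum_smul {s : Finset ℕ} {e : ℕ → E}
    (he : ∀ i ∈ s, ∀ j ∈ s, inner ℝ (e i) (e j) = if i = j then (1 : ℝ) else 0) (a : ℕ → ℝ) :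
    ‖∑ j ∈ s, a j • e j‖ ^ 2 = ∑ j ∈ s, a j ^ 2 := by
  rw [← real_inner_self_eq_norm_sq, sum_inner]
  refine Finset.sum_congr rfl fun i hi => ?_
  rw [inner_sum, Finset.sum_eq_single_of_mem i hi]
  · rw [inner_smul_left, inner_smul_right, he i hi i hi]
    simp [pow_two]
  · intro j hj hij
    rw [inner_smul_left, inner_smul_right, he i hi j hj, if_neg hij.symm]
    simp

/-- A tail estimate for orthogonal series with coefficients of size `1 / j`. -/
lemma norm_sum_smul_le {N M : ℕ} {e : ℕ → E}
    (he : ∀ i ∈ Finset.Ico (N + 1) M, ∀ j ∈ Finset.Ico (N + 1) M,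
      inner ℝ (e i) (e j) = if i = j then (1 : ℝ) else 0) {a : ℕ → ℝ}
    (ha : ∀ j ∈ Finset.Ico (N + 1) M, |a j| ≤ 1 / j) :
    ‖∑ j ∈ Finset.Ico (N + 1) M, a j • e j‖ ≤ √(2 / ((N : ℝ) + 1)) := by
  refine Real.le_sqrt_of_sq_le ?_
  rw [norm_sq_sum_smul he]
  have hI : Finset.Ico (N + 1) M = Finset.Ioo N M := by ext; simp
  refine le_trans ?_ (sum_Ioo_inv_sq_le N M)
  rw [hI] at ha ⊢
  refine Finset.sum_le_sum fun j hj => ?_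
  rw [← one_div, ← one_div_pow, ← sq_abs]
  exact pow_le_pow_left₀ (abs_nonneg _) (ha j hj) 2

lemma tendsto_sqrt_two_div : Tendsto (fun N : ℕ => √(2 / ((N : ℝ) + 1))) atTop (𝓝 0) := by
  have h : Tendsto (fun N : ℕ => 2 / ((N : ℝ) + 1)) atTop (𝓝 0) := by
    have := (tendsto_one_div_add_atTop_nhds_zero_nat (𝕜 := ℝ)).const_mul 2
    rw [mul_zero] at this
    exact this.congr fun N => by rw [mul_one_div]
  have h2 := (Real.continuous_sqrt.tendsto 0).comp h
  rw [Real.sqrt_zero] at h2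
  exact h2

variable {X : Type*} [TopologicalSpace X]

/-- The map `p ↦ a p • e`. -/
def smulVec (a : C(X, ℝ)) (e : E) : C(X, E) := ⟨fun p => a p • e, by fun_prop⟩

@[simp] lemma smulVec_apply (a : C(X, ℝ)) (e : E) (p : X) : smulVec a e p = a p • e := rfl

variable [CompactSpace X]

lemma norm_smulVec_le (a : C(X, ℝ)) (e : E) : ‖smulVec a e‖ ≤ ‖a‖ * ‖e‖ := by
  refine (ContinuousMap.norm_le _ (by positivity)).2 fun p => ?_
  rw [smulVec_apply, norm_smul]
  gcongr
  exact a.norm_coe_le_norm p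

lemma tendsto_smulVec {ι : Type*} {l : Filter ι} {a : ι → C(X, ℝ)} {a₀ : C(X, ℝ)} {e : ι → E}
    {e₀ : E} (ha : Tendsto a l (𝓝 a₀)) (he : Tendsto e l (𝓝 e₀)) :
    Tendsto (fun i => smulVec (a i) (e i)) l (𝓝 (smulVec a₀ e₀)) := by
  rw [tendsto_iff_norm_sub_tendsto_zero] at ha ⊢
  have he' := tendsto_iff_norm_sub_tendsto_zero.1 he
  have h : Tendsto (fun i => ‖a i - a₀‖ * ‖e i‖ + ‖a₀‖ * ‖e i - e₀‖) l (𝓝 0) := by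
    simpa using (ha.mul he.norm).add (he'.const_mul ‖a₀‖)
  refine squeeze_zero (fun _ => norm_nonneg _) (fun i => ?_) h
  have e1 : smulVec (a i) (e i) - smulVec a₀ e₀
      = smulVec (a i - a₀) (e i) + smulVec a₀ (e i - e₀) := by
    ext1 p
    simp [sub_smul, smul_sub]
  rw [e1]
  exact (norm_add_le _ _).trans (add_le_add (norm_smulVec_le _ _) (norm_smulVec_le _ _))

end Orthogonal

/-! ### The Green functions as maps into `L²` -/

section Green

open Real

/-- The coefficients of the Green function. -/
def coef (j : ℕ) (t x : ℝ) : ℝ := sin (j * π * t) / (j * π) * phi j x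

/-- The coefficients of the discrete Green function. -/
def coefD (n j : ℕ) (t x : ℝ) : ℝ :=
  sin (j * π * t * freq n j) / (j * π * freq n j) * interp n (phi j) x

lemma sqrt_two_le_two : √2 ≤ 2 := by
  rw [sqrt_le_left (by norm_num)]; norm_num

lemma abs_coef_le (j : ℕ) (t x : ℝ) : |coef j t x| ≤ 1 / j := by
  rcases Nat.eq_zero_or_pos j with rfl | hj
  · simp [coef]
  have hj' : (0 : ℝ) < j := by exact_mod_cast hj
  rw [coef, abs_mul, abs_div, abs_of_pos (by positivity : 0 < (j : ℝ) * π)]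
  calc _ ≤ 1 / (j * π) * 2 := by
        gcongr
        · exact abs_sin_le_one _
        · exact (abs_phi_le _ _).trans sqrt_two_le_two
    _ ≤ 1 / j := by
        rw [div_mul_eq_mul_div, one_mul, div_le_div_iff₀ (by positivity) hj']
        nlinarith [pi_gt_three]

lemma abs_coefD_le {n j : ℕ} (hj : 0 < j) (hjn : j < n) (t x : ℝ) : |coefD n j t x| ≤ 1 / j := by
  have hj' : (0 : ℝ) < j := by exact_mod_cast hj
  have hf := two_div_pi_le_freq hj hjn
  have hf0 := freq_pos hj hjn
  have hf2 : 2 ≤ π * freq n j := by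
    rw [div_le_iff₀ pi_pos] at hf; linarith
  rw [coefD, abs_mul, abs_div, abs_of_pos (by positivity : 0 < (j : ℝ) * π * freq n j)]
  calc _ ≤ 1 / (j * π * freq n j) * 2 := by
        gcongr
        · exact abs_sin_le_one _
        · exact abs_interp_le (fun x => (abs_phi_le j x).trans sqrt_two_le_two) x
    _ ≤ 1 / j := by
        rw [div_mul_eq_mul_div, one_mul, div_le_div_iff₀ (by positivity) hj']
        nlinarith

lemma norm_sum_coef_le (N M : ℕ) (t x : ℝ) :
    ‖∑ j ∈ Finset.Ico (N + 1) M, coef j t x • sineVec j‖ ≤ √(2 / ((N : ℝ) + 1)) :=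
  norm_sum_smul_le (fun i hi _ _ => inner_sineVec (by simp at hi; omega))
    fun j _ => abs_coef_le j t x

lemma norm_sum_coefD_le (N n : ℕ) (t x : ℝ) :
    ‖∑ j ∈ Finset.Ico (N + 1) n, coefD n j t x • sineVecD n j‖ ≤ √(2 / ((N : ℝ) + 1)) :=
  norm_sum_smul_le (fun i hi j hj => by
      simp only [Finset.mem_Ico] at hi hj
      exact inner_sineVecD (by omega) (by omega) (by omega))
    fun j hj => by
      simp only [Finset.mem_Ico] at hj
      exact abs_coefD_le (by omega) (by omega) t x

lemma dist_sum_coef_le {N M : ℕ} (h : N ≤ M) (t x : ℝ) :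
    dist (∑ j ∈ Finset.Ico 1 (M + 1), coef j t x • sineVec j)
      (∑ j ∈ Finset.Ico 1 (N + 1), coef j t x • sineVec j) ≤ √(2 / ((N : ℝ) + 1)) := by
  rw [dist_eq_norm, sum_Ico_eq_add (Nat.lt_succ_of_le h), add_sub_cancel_left]
  exact norm_sum_coef_le _ _ _ _

lemma exists_greenVec (t x : ℝ) : ∃ w : L2I,
    Tendsto (fun N : ℕ => ∑ j ∈ Finset.Ico 1 (N + 1), coef j t x • sineVec j) atTop (𝓝 w) := by
  refine cauchySeq_tendsto_of_complete (cauchySeq_of_le_tendsto_0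
    (fun N : ℕ => √(2 / ((N : ℝ) + 1)) + √(2 / ((N : ℝ) + 1))) (fun n m N hn hm => ?_) ?_)
  · refine (dist_triangle_right _ _ (∑ j ∈ Finset.Ico 1 (N + 1), coef j t x • sineVec j)).trans ?_
    exact add_le_add (dist_sum_coef_le hn t x) (dist_sum_coef_le hm t x)
  · simpa using tendsto_sqrt_two_div.add tendsto_sqrt_two_div

/-- The Green function `G_t(x, ·)` in `L²`. -/
def greenVec (t x : ℝ) : L2I := Classical.choose (exists_greenVec t x)

lemma tendsto_greenVec (t x : ℝ) :
    Tendsto (fun N : ℕ => ∑ j ∈ Finset.Ico 1 (N + 1), coef j t x • sineVec j) atTop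
      (𝓝 (greenVec t x)) := Classical.choose_spec (exists_greenVec t x)

lemma dist_greenVec_le (N : ℕ) (t x : ℝ) :
    dist (greenVec t x) (∑ j ∈ Finset.Ico 1 (N + 1), coef j t x • sineVec j)
      ≤ √(2 / ((N : ℝ) + 1)) := by
  refine le_of_tendsto ((tendsto_greenVec t x).dist tendsto_const_nhds) ?_
  filter_upwards [eventually_ge_atTop N] with M hM using dist_sum_coef_le hM t x

/-- The tail estimate at `N = 0`, where the partial sum is empty. -/
lemma norm_greenVec_le (t x : ℝ) : ‖greenVec t x‖ ≤ √2 := by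
  simpa using dist_greenVec_le 0 t x

lemma sum_Icc_eq (N : ℕ) (t x z : ℝ) :
    ∑ j ∈ Finset.Icc 1 N, sin (j * π * t) / (j * π) * phi j x * phi j z
      = ∑ j ∈ Finset.Ico 1 (N + 1), coef j t x * phi j z := by
  rfl

/-- Convergence in `L²` yields an almost everywhere convergent subsequence of partial sums. The
pointwise limit along it is `green`, since the series converges everywhere. -/
lemma coeFn_greenVec (t x : ℝ) :
    greenVec t x =ᵐ[(volume : Measure ℝ).restrict (Icc (0 : ℝ) 1)] green t x := by
  obtain ⟨ns, hns, hlim⟩ :=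
    (tendstoInMeasure_of_tendsto_Lp (tendsto_greenVec t x)).exists_seq_tendsto_ae
  have h1 : ∀ᵐ z ∂(volume : Measure ℝ).restrict (Icc (0 : ℝ) 1), ∀ N : ℕ,
      (∑ j ∈ Finset.Ico 1 (N + 1), coef j t x • sineVec j : L2I) z
        = ∑ j ∈ Finset.Ico 1 (N + 1), coef j t x * phi j z :=
    ae_all_iff.2 fun N => coeFn_sum_smul_toLp (fun j => memLp_restr (continuousOn_phi j)) _ _
  filter_upwards [hlim, h1] with z h2 h3
  refine tendsto_nhds_unique h2 ?_
  simp only [h3]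
  exact ((tendsto_green t x z).comp hns.tendsto_atTop).congr fun N => sum_Icc_eq _ _ _ _

lemma inner_greenVec_sineVec {k : ℕ} (hk : 1 ≤ k) (t x : ℝ) :
    inner ℝ (greenVec t x) (sineVec k) = coef k t x := by
  refine tendsto_nhds_unique ((tendsto_greenVec t x).inner tendsto_const_nhds) ?_
  refine tendsto_const_nhds.congr' ?_
  filter_upwards [eventually_ge_atTop k] with N hN
  rw [sum_inner, Finset.sum_eq_single_of_mem k (by simp; omega)]
  · rw [inner_smul_left, inner_sineVec hk]; simp
  · intro j hj hjk
    rw [inner_smul_left, inner_sineVec (by simp at hj; omega), if_neg hjk]; simp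

lemma integral_green_mul (t x : ℝ) {w : ℝ → ℝ} (hw : ContinuousOn w (Icc 0 1)) :
    ∫ z in (0 : ℝ)..1, green t x z * w z = inner ℝ (greenVec t x) (restr hw) := by
  rw [intervalIntegral.integral_of_le zero_le_one, ← integral_Icc_eq_integral_Ioc, L2.inner_def]
  refine integral_congr_ae ?_
  filter_upwards [coeFn_greenVec t x, (memLp_restr hw).coeFn_toLp] with z h1 h2
  rw [restr, h1, h2]; simp [mul_comm]

variable {T : ℝ}

/-- The Green function as a continuous map into `L²`. -/
def greenMap (T : ℝ) : C(OT T, L2I) where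
  toFun p := greenVec p.1.1 p.1.2
  continuous_toFun := by
    -- The tail bound does not depend on `p`, so the limit of the continuous partial sums is
    -- uniform.
    have h : TendstoUniformly (fun (N : ℕ) (p : OT T) =>
        ∑ j ∈ Finset.Ico 1 (N + 1), coef j p.1.1 p.1.2 • sineVec j)
        (fun p => greenVec p.1.1 p.1.2) atTop := by
      rw [Metric.tendstoUniformly_iff]
      intro ε hε
      filter_upwards [tendsto_sqrt_two_div.eventually (gt_mem_nhds hε)] with N hN p
      exact (dist_greenVec_le _ _ _).trans_lt hN
    refine h.continuous (Frequently.of_forall fun N => ?_)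
    refine continuous_finsetSum _ fun j _ => ?_
    have := continuous_phi j
    unfold coef
    fun_prop

/-- The discrete Green function as a continuous map into `L²`. -/
def greenDMap (T : ℝ) (n : ℕ) : C(OT T, L2I) where
  toFun p := ∑ j ∈ Finset.Ico 1 n, coefD n j p.1.1 p.1.2 • sineVecD n j
  continuous_toFun := by
    refine continuous_finsetSum _ fun j _ => ?_
    have := continuous_interp (n := n) (phi j)
    unfold coefD
    fun_prop

lemma norm_greenMap_le (T : ℝ) : ‖greenMap T‖ ≤ √2 :=
  (ContinuousMap.norm_le _ (sqrt_nonneg 2)).2 fun _ => norm_greenVec_le _ _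

lemma norm_greenDMap_le (T : ℝ) (n : ℕ) : ‖greenDMap T n‖ ≤ √2 :=
  (ContinuousMap.norm_le _ (sqrt_nonneg 2)).2 fun p => by
    have h := norm_sum_coefD_le 0 n p.1.1 p.1.2
    have e : √(2 / (((0 : ℕ) : ℝ) + 1)) = √2 := by norm_num
    rw [e] at h
    exact h

lemma represents_green (T : ℝ) : Represents green (greenMap T) where
  measurable x := by
    refine measurable_of_tendsto_metrizable (f := fun (N : ℕ) (q : ℝ × ℝ) =>
      ∑ j ∈ Finset.Icc 1 N, sin (j * π * q.1) / (j * π) * phi j x * phi j q.2) (fun N => ?_)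
      (tendsto_pi_nhds.2 fun q => tendsto_green q.1 x q.2)
    refine Finset.measurable_sum _ fun j _ => ?_
    have := (continuous_phi j).measurable
    fun_prop
  zero x z := tendsto_nhds_unique (tendsto_green 0 x z) (by simp)
  ae p := coeFn_greenVec _ _

lemma greenD_eq (n : ℕ) (t x z : ℝ) :
    greenD n t x z = ∑ j ∈ Finset.Ico 1 n, coefD n j t x * phi j (kappa n z) := rfl

lemma represents_greenD (T : ℝ) (n : ℕ) : Represents (greenD n) (greenDMap T n) where
  measurable x := by
    unfold greenD
    refine Finset.measurable_sum _ fun j _ => ?_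
    have h : Measurable fun q : ℝ × ℝ => phi j (kappa n q.2) :=
      (measurable_comp_kappa n (phi j)).comp measurable_snd
    refine Measurable.mul ?_ h
    fun_prop
  zero x z := by simp [greenD]
  ae p := coeFn_sum_smul_toLp (fun j => memLp_restrD n (continuousOn_phi j)) _ _

lemma integral_greenD_mul (T : ℝ) (n : ℕ) (p : OT T) {w : ℝ → ℝ}
    (hw : ContinuousOn w (Icc 0 1)) :
    ∫ z in (0 : ℝ)..1, greenD n p.1.1 p.1.2 z * w (kappa n z)
      = inner ℝ (greenDMap T n p) (restrD n hw) := by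
  rw [intervalIntegral.integral_of_le zero_le_one, ← integral_Icc_eq_integral_Ioc, L2.inner_def]
  refine integral_congr_ae ?_
  filter_upwards [(represents_greenD T n).ae p, (memLp_restrD n hw).coeFn_toLp] with z h1 h2
  rw [restrD, h1, h2]; simp [mul_comm]

/-- The time factor of the discrete Green function, as a function of the frequency correction. -/
def sinMap (T : ℝ) (j : ℕ) : C(ℝ, C(OT T, ℝ)) :=
  ContinuousMap.curry ⟨fun q : ℝ × OT T =>
      -- The cutoff at `1 / 2` makes the quotient continuous for every real frequency. It has no
      -- effect at `1` or at `freq n j` for `0 < j < n`, which is at least `2 / π`.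
      sin (j * π * q.2.1.1 * q.1) / (j * π * max q.1 (1 / 2)), by
    rcases Nat.eq_zero_or_pos j with rfl | hj
    · simpa using continuous_const
    have hj' : (0 : ℝ) < j := by exact_mod_cast hj
    refine Continuous.div (by fun_prop) (by fun_prop) fun q => ?_
    have : 0 < max q.1 (1 / 2) := lt_max_of_lt_right (by norm_num)
    positivity⟩

/-- The time factor of the derivative of the discrete Green function. -/
def cosMap (T : ℝ) (j : ℕ) : C(ℝ, C(OT T, ℝ)) :=
  ContinuousMap.curry ⟨fun q : ℝ × OT T => cos (j * π * q.2.1.1 * q.1), by fun_prop⟩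

/-- The function `(t, x) ↦ φ_j(x)`. -/
def phiMap (T : ℝ) (j : ℕ) : C(OT T, ℝ) :=
  ⟨fun p => phi j p.1.2, (continuous_phi j).comp (by fun_prop)⟩

/-- The function `(t, x) ↦ Π_n(φ_j)(x)`. -/
def interpMap (T : ℝ) (n j : ℕ) : C(OT T, ℝ) :=
  ⟨fun p => interp n (phi j) p.1.2, (continuous_interp _).comp (by fun_prop)⟩

@[simp] lemma cosMap_apply (j : ℕ) (r : ℝ) (p : OT T) :
    cosMap T j r p = cos (j * π * p.1.1 * r) := rfl

@[simp] lemma phiMap_apply (j : ℕ) (p : OT T) : phiMap T j p = phi j p.1.2 := rfl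

@[simp] lemma interpMap_apply (n j : ℕ) (p : OT T) :
    interpMap T n j p = interp n (phi j) p.1.2 := rfl

lemma sinMap_one_mul_phiMap (j : ℕ) (p : OT T) :
    (sinMap T j 1 * phiMap T j) p = coef j p.1.1 p.1.2 := by
  have h : sinMap T j 1 p = sin (j * π * p.1.1 * 1) / (j * π * max 1 (1 / 2)) := rfl
  rw [ContinuousMap.mul_apply, h, max_eq_left (by norm_num), mul_one, mul_one]; rfl

lemma sinMap_freq_mul_interpMap {n j : ℕ} (hj : 0 < j) (hjn : j < n) (p : OT T) :
    (sinMap T j (freq n j) * interpMap T n j) p = coefD n j p.1.1 p.1.2 := by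
  have h : sinMap T j (freq n j) p
      = sin (j * π * p.1.1 * freq n j) / (j * π * max (freq n j) (1 / 2)) := rfl
  have hf := two_div_pi_le_freq hj hjn
  have h2 : 1 / 2 ≤ 2 / π := by
    rw [div_le_div_iff₀ (by norm_num) pi_pos]; linarith [pi_le_four]
  rw [ContinuousMap.mul_apply, h, max_eq_left (h2.trans hf)]; rfl

lemma tendsto_interpMap (T : ℝ) (j : ℕ) :
    Tendsto (fun n => interpMap T n j) atTop (𝓝 (phiMap T j)) := by
  rw [tendsto_iff_norm_sub_tendsto_zero]
  have h : Tendsto (fun n : ℕ => √2 * (j * π) * (1 / (n : ℝ))) atTop (𝓝 0) := by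
    simpa using (tendsto_one_div_atTop_nhds_zero_nat (𝕜 := ℝ)).const_mul (√2 * (j * π))
  refine squeeze_zero' (Eventually.of_forall fun _ => norm_nonneg _) ?_ h
  filter_upwards [eventually_gt_atTop 0] with n hn
  exact (ContinuousMap.norm_le _ (by positivity)).2 fun p =>
    abs_interp_sub_le hn (by positivity) (abs_phi_sub_le j) _

/-- The tails beyond mode `N` are small uniformly in `n` and `p`, and each of the finitely many
remaining modes converges uniformly on the rectangle. -/
lemma tendsto_greenDMap (T : ℝ) : Tendsto (greenDMap T) atTop (𝓝 (greenMap T)) := by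
  rw [tendsto_iff_norm_sub_tendsto_zero, Metric.tendsto_nhds]
  intro ε hε
  obtain ⟨N, hN⟩ := (tendsto_sqrt_two_div.eventually
    (gt_mem_nhds (by positivity : 0 < ε / 4))).exists
  have hpart : Tendsto (fun n => ∑ j ∈ Finset.Ico 1 (N + 1),
      smulVec (sinMap T j (freq n j) * interpMap T n j) (sineVecD n j)) atTop
      (𝓝 (∑ j ∈ Finset.Ico 1 (N + 1), smulVec (sinMap T j 1 * phiMap T j) (sineVec j))) := by
    refine tendsto_finsetSum _ fun j hj => tendsto_smulVec ?_ (tendsto_sineVecD j)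
    refine Tendsto.mul ?_ (tendsto_interpMap T j)
    exact ((sinMap T j).continuous.tendsto 1).comp (tendsto_freq (by simp at hj; omega))
  rw [tendsto_iff_norm_sub_tendsto_zero] at hpart
  filter_upwards [hpart.eventually (gt_mem_nhds (by positivity : 0 < ε / 4)),
    eventually_gt_atTop N] with n hn hnN
  rw [Real.dist_0_eq_abs, abs_norm]
  refine lt_of_le_of_lt ((ContinuousMap.norm_le _ (by positivity : 0 ≤ 3 * (ε / 4))).2 fun p => ?_)
    (by linarith)
  set A := ∑ j ∈ Finset.Ico 1 (N + 1), coefD n j p.1.1 p.1.2 • sineVecD n j with hA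
  set B := ∑ j ∈ Finset.Ico 1 (N + 1), coef j p.1.1 p.1.2 • sineVec j with hB
  have h1 : ‖greenDMap T n p - A‖ ≤ ε / 4 := by
    have e : greenDMap T n p = A + ∑ j ∈ Finset.Ico (N + 1) n,
        coefD n j p.1.1 p.1.2 • sineVecD n j := sum_Ico_eq_add hnN _
    rw [e, add_sub_cancel_left]
    exact (norm_sum_coefD_le _ _ _ _).trans hN.le
  have h2 : ‖greenMap T p - B‖ ≤ ε / 4 := by
    rw [← dist_eq_norm]
    exact (dist_greenVec_le _ _ _).trans hN.le
  have h3 : ‖A - B‖ ≤ ε / 4 := by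
    refine le_trans (le_of_eq ?_) ((ContinuousMap.norm_coe_le_norm _ p).trans hn.le)
    rw [ContinuousMap.sub_apply, ContinuousMap.sum_apply, ContinuousMap.sum_apply]
    congr 2
    · refine Finset.sum_congr rfl fun j hj => ?_
      simp only [Finset.mem_Ico] at hj
      rw [smulVec_apply, sinMap_freq_mul_interpMap (by omega) (by omega)]
    · exact Finset.sum_congr rfl fun j _ => by rw [smulVec_apply, sinMap_one_mul_phiMap]
  have e : (greenDMap T n - greenMap T) p
      = (greenDMap T n p - A) + (A - B) - (greenMap T p - B) := by
    rw [ContinuousMap.sub_apply]; abel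
  rw [e]
  refine (norm_sub_le _ _).trans ?_
  linarith [norm_add_le (greenDMap T n p - A) (A - B)]

end Green

/-! ### The contribution of the initial data -/

section Initial

open Real

variable {T : ℝ} {u : ℝ → ℝ}

/-- The contribution of the `j`-th mode of the initial position. -/
def modeMap (T : ℝ) (hu : ContinuousOn u (Icc 0 1)) (j : ℕ) : C(OT T, ℝ) :=
  (inner ℝ (sineVec j) (restr hu) : ℝ) • (cosMap T j 1 * phiMap T j)

/-- The contribution of the `j`-th mode of the initial position to the discrete solution. -/
def modeMapD (T : ℝ) (n : ℕ) (hu : ContinuousOn u (Icc 0 1)) (j : ℕ) : C(OT T, ℝ) :=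
  if j ∈ Finset.Ico 1 n then
    (inner ℝ (sineVecD n j) (restrD n hu) : ℝ) • (cosMap T j (freq n j) * interpMap T n j)
  else 0

/-- Quadratic decay of the discrete sine coefficients, uniformly in the mesh size. -/
def CoefDecay (hu : ContinuousOn u (Icc 0 1)) (M : ℝ) : Prop :=
  ∀ n j : ℕ, 0 < j → j < n → |inner ℝ (sineVecD n j) (restrD n hu)| ≤ M / j ^ 2

lemma exists_coefDecay (hu : ContDiffOn ℝ 2 u (Icc 0 1)) (hu0 : u 0 = 0) (hu1 : u 1 = 0) :
    ∃ M, CoefDecay hu.continuousOn M := by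
  obtain ⟨M, hM0, hM⟩ := exists_second_difference_le hu
  refine ⟨M, fun n j hj hjn => ?_⟩
  rw [sineVecD, inner_restrD (by omega)]
  exact abs_discrete_coef_le hu0 hu1 hM0 hM hj hjn

variable {hu : ContinuousOn u (Icc 0 1)} {M : ℝ}

lemma tendsto_inner_sineVecD (hu : ContinuousOn u (Icc 0 1)) (j : ℕ) :
    Tendsto (fun n => inner ℝ (sineVecD n j) (restrD n hu)) atTop
      (𝓝 (inner ℝ (sineVec j) (restr hu))) :=
  (tendsto_sineVecD j).inner (tendsto_restrD hu)

lemma CoefDecay.nonneg (h : CoefDecay hu M) : 0 ≤ M := by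
  have := (abs_nonneg _).trans (h 2 1 one_pos one_lt_two)
  simpa using this

/-- The discrete bound is uniform in `n` and passes to the limit, so no separate integration by
parts is required. -/
lemma CoefDecay.abs_inner_le (h : CoefDecay hu M) {j : ℕ} (hj : 0 < j) :
    |inner ℝ (sineVec j) (restr hu)| ≤ M / j ^ 2 := by
  refine le_of_tendsto (tendsto_inner_sineVecD hu j).abs ?_
  filter_upwards [eventually_gt_atTop j] with n hn using h n j hj hn

lemma CoefDecay.summable (M : ℝ) : Summable fun j : ℕ => M / (j : ℝ) ^ 2 * √2 := by
  simpa only [mul_one_div] using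
    (((summable_one_div_nat_pow (p := 2)).2 one_lt_two).mul_left M).mul_right √2

lemma norm_cosMap_mul_le {j : ℕ} {r : ℝ} {f : C(OT T, ℝ)} (hf : ∀ p, |f p| ≤ √2) :
    ‖cosMap T j r * f‖ ≤ √2 := by
  refine (ContinuousMap.norm_le _ (sqrt_nonneg 2)).2 fun p => ?_
  rw [ContinuousMap.mul_apply, norm_mul, cosMap_apply]
  calc _ ≤ 1 * √2 := mul_le_mul (abs_cos_le_one _) (hf p) (abs_nonneg _) zero_le_one
    _ = √2 := one_mul _

lemma CoefDecay.norm_modeMap_le (h : CoefDecay hu M) (j : ℕ) :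
    ‖modeMap T hu j‖ ≤ M / (j : ℝ) ^ 2 * √2 := by
  have hM := h.nonneg
  -- At `j = 0` the bound reads `0`, as division by zero gives `0`; it holds because `φ_0 = 0`.
  rcases Nat.eq_zero_or_pos j with rfl | hj
  · have : phiMap T 0 = 0 := by ext p; simp [phi_zero]
    simp [modeMap, this]
  · rw [modeMap, norm_smul]
    exact mul_le_mul (h.abs_inner_le hj) (norm_cosMap_mul_le fun p => abs_phi_le _ _)
      (norm_nonneg _) (by positivity)

lemma CoefDecay.norm_modeMapD_le (h : CoefDecay hu M) (n j : ℕ) :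
    ‖modeMapD T n hu j‖ ≤ M / (j : ℝ) ^ 2 * √2 := by
  have hM := h.nonneg
  rw [modeMapD]
  split_ifs with hj
  · rw [Finset.mem_Ico] at hj
    rw [norm_smul]
    exact mul_le_mul (h n j (by omega) hj.2)
      (norm_cosMap_mul_le fun p => abs_interp_le (abs_phi_le _) _) (norm_nonneg _) (by positivity)
  · rw [norm_zero]; positivity

lemma tendsto_modeMapD (T : ℝ) (hu : ContinuousOn u (Icc 0 1)) (j : ℕ) :
    Tendsto (fun n => modeMapD T n hu j) atTop (𝓝 (modeMap T hu j)) := by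
  rcases Nat.eq_zero_or_pos j with rfl | hj
  · have : phiMap T 0 = 0 := by ext p; simp [phi_zero]
    simp [modeMap, modeMapD, this]
  · have h : Tendsto (fun n => (inner ℝ (sineVecD n j) (restrD n hu) : ℝ) •
        (cosMap T j (freq n j) * interpMap T n j)) atTop (𝓝 (modeMap T hu j)) := by
      refine (tendsto_inner_sineVecD hu j).smul (Tendsto.mul ?_ (tendsto_interpMap T j))
      exact ((cosMap T j).continuous.tendsto 1).comp (tendsto_freq hj)
    refine h.congr' ?_
    filter_upwards [eventually_gt_atTop j] with n hn
    rw [modeMapD, if_pos (Finset.mem_Ico.2 ⟨hj, hn⟩)]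

/-- Tannery's theorem with majorant `√2 M / j ^ 2`. Extending the discrete sum by zero beyond `n`
puts both sums over the same index set. -/
lemma CoefDecay.tendsto_tsum_modeMapD (h : CoefDecay hu M) :
    Tendsto (fun n => ∑' j, modeMapD T n hu j) atTop (𝓝 (∑' j, modeMap T hu j)) :=
  tendsto_tsum_of_dominated_convergence (CoefDecay.summable M) (tendsto_modeMapD T hu)
    (Eventually.of_forall fun n j => h.norm_modeMapD_le n j)

lemma hasDerivAt_coef (j : ℕ) (t x : ℝ) :
    HasDerivAt (fun τ => coef j τ x) (cos (j * π * t) * phi j x) t := by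
  unfold coef
  rcases Nat.eq_zero_or_pos j with rfl | hj
  · simpa [phi_zero] using hasDerivAt_const t (0 : ℝ)
  have hj' : (j : ℝ) * π ≠ 0 := by positivity
  have h := ((((hasDerivAt_id t).const_mul ((j : ℝ) * π)).sin).div_const ((j : ℝ) * π)).mul_const
    (phi j x)
  refine h.congr_deriv ?_
  simp only [id, mul_one]
  field_simp

lemma hasDerivAt_coefD {n j : ℕ} (hj : 0 < j) (hjn : j < n) (t x : ℝ) :
    HasDerivAt (fun τ => coefD n j τ x) (cos (j * π * t * freq n j) * interp n (phi j) x) t := by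
  unfold coefD
  have hf := freq_pos hj hjn
  have hj' : (0 : ℝ) < j := by exact_mod_cast hj
  have h := (((((hasDerivAt_id t).const_mul ((j : ℝ) * π)).mul_const (freq n j)).sin).div_const
    ((j : ℝ) * π * freq n j)).mul_const (interp n (phi j) x)
  refine h.congr_deriv ?_
  simp only [id, mul_one]
  field_simp

/-- Valid for every real `t`, as needed to differentiate at the endpoints of `[0, T]`. -/
lemma CoefDecay.hasSum_integral_green (h : CoefDecay hu M) (t x : ℝ) :
    HasSum (fun j => coef j t x * inner ℝ (sineVec j) (restr hu))
      (∫ z in (0 : ℝ)..1, green t x z * u z) := by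
  have hM := h.nonneg
  have hsum : Summable fun j => coef j t x * inner ℝ (sineVec j) (restr hu) := by
    refine Summable.of_norm_bounded
      (g := fun j : ℕ => M * (1 / (j : ℝ) ^ 2))
      (((summable_one_div_nat_pow (p := 2)).2 one_lt_two).mul_left M) fun j => ?_
    rcases Nat.eq_zero_or_pos j with rfl | hj
    · simp [coef]
    · have hj' : (1 : ℝ) ≤ j := by exact_mod_cast hj
      rw [norm_mul]
      calc _ ≤ 1 * (M / (j : ℝ) ^ 2) :=
            mul_le_mul ((abs_coef_le j t x).trans ((div_le_one (by positivity)).2 hj'))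
              (h.abs_inner_le hj) (abs_nonneg _) zero_le_one
        _ = _ := by ring
  convert hsum.hasSum using 1
  rw [integral_green_mul t x hu]
  refine tendsto_nhds_unique ((tendsto_greenVec t x).inner tendsto_const_nhds)
    ((hsum.hasSum.tendsto_sum_nat.comp (tendsto_add_atTop_nat 1)).congr fun N => ?_)
  simp only [Function.comp]
  rw [Finset.sum_range_eq_add_Ico _ (by omega), sum_inner]
  simp [coef, phi_zero, inner_smul_left]

/-- Differentiation removes the factor `1 / (j π)`, so termwise differentiation rests on the
quadratic decay of the sine coefficients of `u`. This is where the `C²` regularity and the boundary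
values of the initial position enter. -/
lemma CoefDecay.deriv_integral_green (h : CoefDecay hu M) (p : OT T) :
    deriv (fun τ => ∫ z in (0 : ℝ)..1, green τ p.1.2 z * u z) p.1.1
      = (∑' j, modeMap T hu j) p := by
  have hM := h.nonneg
  have hsm : Summable (modeMap T hu) :=
    Summable.of_norm_bounded (CoefDecay.summable M) h.norm_modeMap_le
  have e : (fun τ => ∫ z in (0 : ℝ)..1, green τ p.1.2 z * u z)
      = fun τ => ∑' j, coef j τ p.1.2 * inner ℝ (sineVec j) (restr hu) :=
    funext fun τ => (h.hasSum_integral_green τ p.1.2).tsum_eq.symm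
  rw [e, (hasDerivAt_tsum (CoefDecay.summable M)
    (fun j τ => (hasDerivAt_coef j τ p.1.2).mul_const (inner ℝ (sineVec j) (restr hu)))
    (fun j τ => ?_) (h.hasSum_integral_green 0 p.1.2).summable p.1.1).deriv,
    ← ContinuousMap.tsum_apply hsm]
  · refine tsum_congr fun j => ?_
    simp [modeMap, mul_comm]
  · rcases Nat.eq_zero_or_pos j with rfl | hj
    · simp [phi_zero]
    rw [norm_mul, mul_comm]
    refine mul_le_mul (h.abs_inner_le hj) ?_ (norm_nonneg _) (by positivity)
    rw [norm_mul]
    calc _ ≤ 1 * √2 := mul_le_mul (abs_cos_le_one _) (abs_phi_le _ _) (abs_nonneg _) zero_le_one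
      _ = √2 := one_mul _

lemma integral_deriv_greenD (n : ℕ) (hu : ContinuousOn u (Icc 0 1)) (p : OT T) :
    ∫ z in (0 : ℝ)..1, deriv (fun τ => greenD n τ p.1.2 z) p.1.1 * u (kappa n z)
      = (∑' j, modeMapD T n hu j) p := by
  have hd : ∀ z, deriv (fun τ => greenD n τ p.1.2 z) p.1.1 = ∑ j ∈ Finset.Ico 1 n,
      cos (j * π * p.1.1 * freq n j) * interp n (phi j) p.1.2 * phi j (kappa n z) := by
    intro z
    simp_rw [greenD_eq]
    refine (HasDerivAt.fun_sum fun j hj => ?_).deriv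
    rw [Finset.mem_Ico] at hj
    exact (hasDerivAt_coefD (by omega) hj.2 _ _).mul_const _
  rw [tsum_eq_sum (s := Finset.Ico 1 n) fun j hj => by rw [modeMapD, if_neg hj],
    ContinuousMap.sum_apply, intervalIntegral.integral_of_le zero_le_one,
    ← integral_Icc_eq_integral_Ioc]
  simp_rw [hd, Finset.sum_mul]
  rw [integral_finsetSum]
  · refine Finset.sum_congr rfl fun j hj => ?_
    rw [modeMapD, if_pos hj]
    simp only [mul_assoc]
    rw [integral_const_mul, integral_const_mul, sineVecD, restrD, restrD, inner_toLp_eq]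
    simp only [ContinuousMap.smul_apply, ContinuousMap.mul_apply, cosMap_apply, interpMap_apply,
      smul_eq_mul, ← mul_assoc]
    ring
  · intro j _
    simp only [mul_assoc]
    exact (((memLp_restrD n (continuousOn_phi j)).integrable_mul
      (memLp_restrD n hu)).const_mul _).const_mul _

end Initial

/-! ### The wave equation as an abstract skeleton equation -/

section Wave

variable {T : ℝ} {u₀ v₀ : ℝ → ℝ}

/-- The data of the skeleton equation. -/
def waveData (hT : 0 ≤ T) (hu : ContinuousOn u₀ (Icc 0 1)) (hv : ContinuousOn v₀ (Icc 0 1)) :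
    SkeletonData T where
  ker := (represents_green T).ker hT
  init := pair (greenMap T) (restr hv) + ∑' j, modeMap T hu j
  node := id
  measurable_node := measurable_id

/-- The data of the discrete skeleton equation. -/
def waveDataD (hT : 0 ≤ T) (n : ℕ) (hu : ContinuousOn u₀ (Icc 0 1))
    (hv : ContinuousOn v₀ (Icc 0 1)) : SkeletonData T where
  ker := (represents_greenD T n).ker hT
  init := pair (greenDMap T n) (restrD n hv) + ∑' j, modeMapD T n hu j
  node := kappa n
  measurable_node := measurable_kappa n

lemma nodeEv_kappa_eventually_le (f : C(OT T, ℝ)) {ε : ℝ} (hε : 0 < ε) :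
    ∀ᶠ n : ℕ in atTop, ∀ q ∈ OT T, |nodeEv (kappa n) f q - nodeEv id f q| ≤ ε := by
  obtain ⟨δ, hδ, h⟩ := Metric.uniformContinuous_iff.1
    (CompactSpace.uniformContinuous_of_continuous f.continuous) ε hε
  filter_upwards [eventually_gt_atTop 0, tendsto_one_div_atTop_nhds_zero_nat.eventually
    (gt_mem_nhds hδ)] with n hn hn' q hq
  have hq' : (q.1, kappa n q.2) ∈ OT T := ⟨hq.1, kappa_mem_Icc hq.2⟩
  have e1 := ev_coe f ⟨_, hq'⟩
  have e2 := ev_coe f ⟨q, hq⟩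
  simp only [nodeEv, id] at e1 e2 ⊢
  rw [e1, e2]
  refine (h ?_).le
  rw [Subtype.dist_eq, Prod.dist_eq, dist_self, Real.dist_eq]
  exact max_lt hδ ((abs_kappa_sub_le hn _).trans_lt hn')

lemma dataTendsto_waveDataD (hT : 0 ≤ T) {hu : ContinuousOn u₀ (Icc 0 1)}
    (hv : ContinuousOn v₀ (Icc 0 1)) {M : ℝ} (hM : CoefDecay hu M) :
    DataTendsto (fun n => waveDataD hT n hu hv) atTop (waveData hT hu hv) where
  ker := by
    rw [tendsto_iff_norm_sub_tendsto_zero]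
    have h : Tendsto (fun n => √T * ‖greenDMap T n - greenMap T‖) atTop (𝓝 0) := by
      simpa using (tendsto_iff_norm_sub_tendsto_zero.1 (tendsto_greenDMap T)).const_mul √T
    exact squeeze_zero (fun _ => norm_nonneg _)
      (fun n => (represents_greenD T n).norm_ker_sub_le hT (represents_green T)) h
  init := by
    have hb := (tendsto_restrD hv).norm.eventually (gt_mem_nhds (lt_add_one ‖restr hv‖))
    exact (tendsto_pair (tendsto_greenDMap T) (hb.mono fun _ h => h.le)
      (WeakTendsto.of_tendsto (tendsto_restrD hv))).add hM.tendsto_tsum_modeMapD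
  node f _ hε := nodeEv_kappa_eventually_le f hε

variable {b σ : ℝ → ℝ} {L : ℝ}

lemma isSkeletonSol_iff (hc : LipCoef b σ L) (hT : 0 ≤ T) {hu : ContinuousOn u₀ (Icc 0 1)}
    (hv : ContinuousOn v₀ (Icc 0 1)) {M : ℝ} (hM : CoefDecay hu M) (h : L2OT T)
    (f : C(OT T, ℝ)) :
    IsSkeletonSol b σ u₀ v₀ h f ↔ (waveData hT hu hv).rhs hc h f = f :=
  integral_equation_iff hc hT (represents_green T) (waveData hT hu hv) rfl
    (I := fun t x => (∫ z in (0 : ℝ)..1, green t x z * v₀ z)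
      + deriv (fun τ : ℝ => ∫ z in (0 : ℝ)..1, green τ x z * u₀ z) t)
    (fun p => by
      rw [hM.deriv_integral_green p, integral_green_mul _ _ hv]
      rfl) h f

lemma isDiscreteSkeletonSol_iff (hc : LipCoef b σ L) (hT : 0 ≤ T) (n : ℕ)
    (hu : ContinuousOn u₀ (Icc 0 1)) (hv : ContinuousOn v₀ (Icc 0 1)) (h : L2OT T)
    (f : C(OT T, ℝ)) :
    IsDiscreteSkeletonSol b σ u₀ v₀ n h f ↔ (waveDataD hT n hu hv).rhs hc h f = f :=
  integral_equation_iff hc hT (represents_greenD T n) (waveDataD hT n hu hv) rfl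
    (I := fun t x => (∫ z in (0 : ℝ)..1, greenD n t x z * v₀ (kappa n z))
      + (∫ z in (0 : ℝ)..1, deriv (fun τ : ℝ => greenD n τ x z) t * u₀ (kappa n z)))
    (fun p => by
      rw [integral_deriv_greenD n hu p, integral_greenD_mul T n p hv]
      rfl) h f

/-- The Duhamel kernel of the wave equation does not vanish at interior points. -/
lemma ker_green_ne_zero (hT : 0 < T) {x₀ : ℝ} (hx₀ : x₀ ∈ Ioo (0 : ℝ) 1)
    (hmem : (T, x₀) ∈ OT T) : (represents_green T).ker hT.le ⟨(T, x₀), hmem⟩ ≠ 0 := by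
  intro hzero
  set p : OT T := ⟨(T, x₀), hmem⟩ with hp
  have hpi := Real.pi_pos
  -- This test function isolates the first mode: the spatial integral against the kernel is `sin² (π
  -- (T - s)) / π * φ_1 (x₀)`, which is nonnegative and not identically zero in `s`.
  let F : ℝ × ℝ → ℝ := fun q => Real.sin (Real.pi * (T - q.1)) * phi 1 q.2
  have hFm : MemLp F 2 ((volume : Measure (ℝ × ℝ)).restrict (OT T)) := by
    have hcont : Continuous F := by
      have := continuous_phi 1
      fun_prop
    refine MemLp.of_bound hcont.aestronglyMeasurable √2 (Eventually.of_forall fun q => ?_)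
    rw [norm_mul]
    calc _ ≤ 1 * √2 := mul_le_mul (Real.abs_sin_le_one _) (abs_phi_le _ _) (abs_nonneg _)
          zero_le_one
      _ = √2 := one_mul _
  have h1 : ∫ q in OT T, duhamelFun green p q * F q = 0 := by
    have h2 := inner_eq_integral ((represents_green T).ker hT.le p) (hFm.toLp F)
    rw [hzero, inner_zero_left] at h2
    rw [h2, ← hzero]
    refine integral_congr_ae ?_
    filter_upwards [(represents_green T).coeFn_ker hT.le p, hFm.coeFn_toLp] with q h3 h4
    rw [h3, h4]
  rw [← (represents_green T).integral_duhamel hT.le p hFm] at h1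
  have hphi : 0 < phi 1 x₀ := by
    have : 0 < Real.sin ((1 : ℕ) * Real.pi * x₀) :=
      Real.sin_pos_of_pos_of_lt_pi (by rw [Nat.cast_one]; nlinarith [hx₀.1])
        (by rw [Nat.cast_one]; nlinarith [hx₀.2])
    unfold phi
    positivity
  have h2 : ∀ s, ∫ z in (0 : ℝ)..1, green (T - s) x₀ z * F (s, z)
      = Real.sin (Real.pi * (T - s)) ^ 2 / Real.pi * phi 1 x₀ := by
    intro s
    have e : ∀ z, green (T - s) x₀ z * F (s, z)
        = Real.sin (Real.pi * (T - s)) * (green (T - s) x₀ z * phi 1 z) := fun z => by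
      simp only [F]; ring
    simp_rw [e]
    rw [intervalIntegral.integral_const_mul, integral_green_mul _ _ (continuousOn_phi 1)]
    have := inner_greenVec_sineVec le_rfl (T - s) x₀
    rw [sineVec] at this
    rw [this, coef, Nat.cast_one, one_mul]
    ring
  simp only [hp, h2] at h1
  refine absurd h1 (intervalIntegral.integral_pos hT (by fun_prop) (fun s _ => by positivity)
    -- At this time `π (T - s) = π min(T, 1) / 2` lies in `(0, π)`, so the integrand is positive.
    ⟨T - min T 1 / 2, ?_, ?_⟩).ne'
  · have h3 : 0 < min T 1 := lt_min hT one_pos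
    have h4 := min_le_left T 1
    constructor <;> linarith
  · have h3 : 0 < min T 1 := lt_min hT one_pos
    have h4 := min_le_right T 1
    have : 0 < Real.sin (Real.pi * (T - (T - min T 1 / 2))) := by
      rw [sub_sub_cancel]
      exact Real.sin_pos_of_pos_of_lt_pi (by positivity) (by nlinarith)
    positivity

lemma tendsto_pnat_val : Tendsto (fun n : ℕ+ => (n : ℕ)) atTop atTop :=
  tendsto_atTop.2 fun m => by
    filter_upwards [eventually_ge_atTop (⟨m + 1, m.succ_pos⟩ : ℕ+)] with n hn
    have : m + 1 ≤ (n : ℕ) := hn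
    omega

end Wave

end

end WaveGamma

theorem theorem3p1
    (T : ℝ) (hT : 0 < T) (x₀ : ℝ) (hx₀ : x₀ ∈ Set.Ioo (0 : ℝ) 1)
    (b σ u₀ v₀ : ℝ → ℝ)
    (hLip : ∃ L > 0, ∀ x z : ℝ, |b x - b z| + |σ x - σ z| ≤ L * |x - z|)
    (hu₀ : ContDiffOn ℝ 2 u₀ (Set.Icc 0 1)) (hu₀0 : u₀ 0 = 0) (hu₀1 : u₀ 1 = 0)
    (hv₀ : ContDiffOn ℝ 1 v₀ (Set.Icc 0 1))
    (hσ : ∀ x : ℝ, σ x ≠ 0)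
    (y : ℝ) :
    -- the skeleton equations are well posed, so the solution maps are meaningful
    ((∀ h : WaveGamma.L2OT T, ∃! f : C(WaveGamma.OT T, ℝ),
        WaveGamma.IsSkeletonSol b σ u₀ v₀ h f) ∧
      (∀ (n : ℕ+) (h : WaveGamma.L2OT T), ∃! f : C(WaveGamma.OT T, ℝ),
        WaveGamma.IsDiscreteSkeletonSol b σ u₀ v₀ n h f)) ∧
    -- every subsequence has a Gamma-convergent further subsequence
    (∀ k : ℕ+ → ℕ+, StrictMono k → ∃ l : ℕ+ → ℕ+, StrictMono l ∧
      WaveGamma.GammaConverges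
        (fun j : ℕ+ => WaveGamma.JD T b σ u₀ v₀ x₀ (k (l j)) y)
        (WaveGamma.J T b σ u₀ v₀ x₀ y)) ∧
    -- the whole sequence Gamma-converges
    WaveGamma.GammaConverges
      (fun n : ℕ+ => WaveGamma.JD T b σ u₀ v₀ x₀ n y)
      (WaveGamma.J T b σ u₀ v₀ x₀ y) := by
  obtain ⟨L, hL, hlip⟩ := hLip
  have hc : WaveGamma.LipCoef b σ L := ⟨hL, hlip⟩
  obtain ⟨M, hM⟩ := WaveGamma.exists_coefDecay hu₀ hu₀0 hu₀1
  have hv := hv₀.continuousOn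
  have hdec : WaveGamma.HasDecay (WaveGamma.waveData hT.le hu₀.continuousOn hv).ker √2 :=
    (WaveGamma.represents_green T).hasDecay hT.le (WaveGamma.norm_greenMap_le T)
  have hdecD : ∀ n, WaveGamma.HasDecay
      (WaveGamma.waveDataD hT.le n hu₀.continuousOn hv).ker √2 := fun n =>
    (WaveGamma.represents_greenD T n).hasDecay hT.le (WaveGamma.norm_greenDMap_le T n)
  have hwp : ∀ h : WaveGamma.L2OT T, ∃! f : C(WaveGamma.OT T, ℝ),
      WaveGamma.IsSkeletonSol b σ u₀ v₀ h f := fun h => by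
    obtain ⟨K, hK⟩ := WaveGamma.exists_unique_and_stable (T := T) hc (Real.sqrt_nonneg 2) ‖h‖
    simpa only [WaveGamma.isSkeletonSol_iff hc hT.le hv hM] using (hK _ h hdec le_rfl).1
  have hwpD : ∀ (n : ℕ+) (h : WaveGamma.L2OT T), ∃! f : C(WaveGamma.OT T, ℝ),
      WaveGamma.IsDiscreteSkeletonSol b σ u₀ v₀ n h f := fun n h => by
    obtain ⟨K, hK⟩ := WaveGamma.exists_unique_and_stable (T := T) hc (Real.sqrt_nonneg 2) ‖h‖
    simpa only [WaveGamma.isDiscreteSkeletonSol_iff hc hT.le n hu₀.continuousOn hv]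
      using (hK _ h (hdecD n) le_rfl).1
  have hS : ∀ h f, WaveGamma.Upsilon T b σ u₀ v₀ h = f ↔
      (WaveGamma.waveData hT.le hu₀.continuousOn hv).rhs hc h f = f := fun h f => by
    rw [← WaveGamma.isSkeletonSol_iff hc hT.le hv hM]
    -- By existence the chosen value is a solution, and by uniqueness it is the only one; hence the
    -- solution map is characterized by the equation.
    have hspec := Classical.epsilon_spec (hwp h).exists
    exact ⟨fun e => e ▸ hspec, fun hf => (hwp h).unique hspec hf⟩
  have hSD : ∀ (n : ℕ+) h f, WaveGamma.UpsilonD T b σ u₀ v₀ n h = f ↔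
      (WaveGamma.waveDataD hT.le n hu₀.continuousOn hv).rhs hc h f = f := fun n h f => by
    rw [← WaveGamma.isDiscreteSkeletonSol_iff hc hT.le]
    have hspec := Classical.epsilon_spec (hwpD n h).exists
    exact ⟨fun e => e ▸ hspec, fun hf => (hwpD n h).unique hspec hf⟩
  have hmem : (T, x₀) ∈ WaveGamma.OT T := ⟨⟨hT.le, le_rfl⟩, hx₀.1.le, hx₀.2.le⟩
  -- The argument applies along any strictly increasing `k`, because `k j ≥ j` forces the mesh size
  -- to zero.
  have hgamma : ∀ k : ℕ+ → ℕ+, StrictMono k → WaveGamma.GammaConverges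
      (fun j : ℕ+ => WaveGamma.JD T b σ u₀ v₀ x₀ (k j) y)
      (WaveGamma.J T b σ u₀ v₀ x₀ y) := fun k hk =>
    WaveGamma.gammaConverges_objective hc hσ
      ((WaveGamma.dataTendsto_waveDataD hT.le hv hM).comp
        (WaveGamma.tendsto_pnat_val.comp (tendsto_atTop_mono (fun _ => hk.le_apply) tendsto_id)))
      (Real.sqrt_nonneg 2) (fun j => hdecD (k j)) hdec (fun j => hSD (k j)) hS hmem
      (WaveGamma.ker_green_ne_zero hT hx₀ hmem) y
  -- Every subsequence already converges, so the further subsequence is the whole of it; `k = id`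
  -- gives the full sequence.
  exact ⟨⟨hwp, hwpD⟩, fun k hk => ⟨id, strictMono_id, hgamma k hk⟩, hgamma id strictMono_id⟩
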